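/- Let $d\in\{2,3\}$. A damped network in $\mathbb{R}^d$ consists of finitely many distinct nodes $\mathbf{x}_i$, split into terminal and internal ones, spring constants $k_{ij}=k_{ji}\ge 0$ and dashpot constants $c_{ij}=c_{ji}\ge 0$ for the pairs of nodes (zero where there is no spring or dashpot), and masses $m_i\ge 0$ and viscous damping coefficients $\eta_i\ge 0$ at the nodes. With $\mathbf{n}_{ij}=(\mathbf{x}_i-\mathbf{x}_j)/\|\mathbf{x}_i-\mathbf{x}_j\|$, $\mathbf{N}_{ij}=\big((\mathbf{e}_i-\mathbf{e}_j)(\mathbf{e}_i-\mathbf{e}_j)^T\big)\otimes(\mathbf{n}_{ij}\mathbf{n}_{ij}^T)$ and $\mathbf{e}=(1,\dots,1)^T\in\mathbb{R}^d$, its stiffness, damping and mass matrices are $$\mathbf{K}=\sum_{\{i,j\}}k_{ij}\mathbf{N}_{ij},\qquad \mathbf{C}=\sum_{\{i,j\}}c_{ij}\mathbf{N}_{ij}+\mathrm{diag}(\eta_1\mathbf{e},\eta_2\mathbf{e},\dots),\qquad \mathbf{M}_{\rm net}=\mathrm{diag}(m_1\mathbf{e},m_2\mathbf{e},\dots).$$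 The network is Rayleigh damped with constants $\alpha,\beta$ if $c_{ij}=\alpha k_{ij}$ and $\eta_i=\beta m_i$ for all $i,j$; then $\mathbf{C}=\alpha\mathbf{K}+\beta\mathbf{M}_{\rm net}$. Its response at $\lambda\in\mathbb{C}$ is $\mathbf{W}$ if for every terminal displacement $\mathbf{u}_B$ there is an extension $\mathbf{u}$ of $\mathbf{u}_B$ to all nodes such that the forces $(\mathbf{K}+\lambda\mathbf{C}+\lambda^2\mathbf{M}_{\rm net})\mathbf{u}$ vanish at the internal nodes, and for all such $\mathbf{u}$ the forces at the terminals are $\mathbf{W}\mathbf{u}_B$. (Where the internal block of $\mathbf{K}+\lambda\mathbf{C}+\lambda^2\mathbf{M}_{\rm net}$ is invertible, $\mathbf{W}$ is its Schur complement.) **Theorem.** Let $\alpha,\beta\ge 0$, let $\mathbf{x}_1,\dots,\mathbf{x}_n\in\mathbb{R}^d$ be distinct points, let $p\ge 0$ and $$\mathbf{W}(\lambda)=(1+\alpha\lambda)\mathbf{A}+(\beta\lambda+\lambda^2)\mathbf{M}-\sum_{j=1}^p\frac{(1+\alpha\lambda)^2\,\mathbf{R}^{(j)}}{\sigma_j+\lambda(\alpha\sigma_j+\beta)+\lambda^2},$$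 where 1. $\sigma_j>0$ and $\mathbf{R}^{(j)}\in\mathbb{R}^{nd\times nd}$ is symmetric positive semidefinite, for $j=1,\dots,p$; 2. $\mathbf{M}=\mathrm{diag}(\mu_1\mathbf{e},\dots,\mu_n\mathbf{e})$ with real $\mu_1,\dots,\mu_n\ge 0$; 3. $\mathbf{A}\in\mathbb{R}^{nd\times nd}$ is symmetric positive semidefinite; 4. $\mathbf{W}(0)=\mathbf{A}-\sum_{j=1}^p\mathbf{R}^{(j)}/\sigma_j$ is symmetric positive semidefinite, and each of its columns $(\mathbf{f}_1^T,\dots,\mathbf{f}_n^T)^T$ is a balanced system of forces at $\mathbf{x}_1,\dots,\mathbf{x}_n$, that is, $\sum_i\mathbf{f}_i=\mathbf{0}$ and $\sum_i\mathbf{x}_i\times\mathbf{f}_i=\mathbf{0}$. Then for every $\varepsilon>0$ and every finite set $S\subset\mathbb{R}^d$ there is a Rayleigh damped network with constants $\alpha,\beta$ and terminals $\mathbf{x}_1,\dots,\mathbf{x}_n$ whose response at $\lambda$ is $\mathbf{W}(\lambda)$ for every $\lambda\in\mathbb{C}$ with $\sigma_j+\lambda(\alpha\sigma_j+\beta)+\lambda^2\neq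 0$ for all $j$, and whose internal nodes all lie outside $S$ and within the $\varepsilon$-neighborhood of the convex hull of the terminals. -/

import Mathlib

/-- A network of springs, dashpots, masses and viscous cavities in `ℝᵈ`, with `n` terminal nodes
(`Sum.inl i`) and `m` internal nodes (`Sum.inr l`).  A pair of nodes not joined by a spring
(resp. dashpot) has spring (resp. damping) constant `0`, and a massless node has mass `0`. -/
structure DampedNetwork (d n m : ℕ) where
  /-- positions of the nodes -/
  pos : Fin n ⊕ Fin m → EuclideanSpace ℝ (Fin d)
  pos_injective : Function.Injective pos
  /-- spring constants -/
  spring : Fin n ⊕ Fin m → Fin n ⊕ Fin m → ℝ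
  spring_symm : ∀ i j, spring i j = spring j i
  spring_nonneg : ∀ i j, 0 ≤ spring i j
  /-- damping constants of the dashpots in parallel with the springs -/
  dashpot : Fin n ⊕ Fin m → Fin n ⊕ Fin m → ℝ
  dashpot_symm : ∀ i j, dashpot i j = dashpot j i
  dashpot_nonneg : ∀ i j, 0 ≤ dashpot i j
  /-- masses of the nodes -/
  mass : Fin n ⊕ Fin m → ℝ
  mass_nonneg : ∀ i, 0 ≤ mass i
  /-- viscous damping coefficients of the cavities surrounding the nodes -/
  cavity : Fin n ⊕ Fin m → ℝ
  cavity_nonneg : ∀ i, 0 ≤ cavity i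

namespace DampedNetwork

variable {d n m : ℕ}

/-- The unit vector `(xᵢ - xⱼ) / ‖xᵢ - xⱼ‖`. -/
noncomputable def dir (N : DampedNetwork d n m) (i j : Fin n ⊕ Fin m) :
    EuclideanSpace ℝ (Fin d) :=
  ‖N.pos i - N.pos j‖⁻¹ • (N.pos i - N.pos j)

/-- The matrix `(eᵢ - eⱼ)(eᵢ - eⱼ)ᵀ ⊗ nᵢⱼ nᵢⱼᵀ` of a single spring of constant one between the
nodes `i` and `j` (it vanishes for `i = j`). -/
noncomputable def bondMatrix (N : DampedNetwork d n m) (i j : Fin n ⊕ Fin m) :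
    Matrix ((Fin n ⊕ Fin m) × Fin d) ((Fin n ⊕ Fin m) × Fin d) ℝ :=
  Matrix.kronecker
    (Matrix.vecMulVec (Pi.single i 1 - Pi.single j 1) (Pi.single i 1 - Pi.single j 1))
    (Matrix.vecMulVec (fun s => N.dir i j s) (fun s => N.dir i j s))

/-- The stiffness matrix `K`, a sum over the springs; the factor `1 / 2` is there because the
double sum meets every unordered pair of nodes twice. -/
noncomputable def stiffnessMatrix (N : DampedNetwork d n m) :
    Matrix ((Fin n ⊕ Fin m) × Fin d) ((Fin n ⊕ Fin m) × Fin d) ℝ :=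
  (1 / 2 : ℝ) • ∑ i, ∑ j, N.spring i j • N.bondMatrix i j

/-- The mass matrix `M = diag (m₁ e, m₂ e, …)`, `e = (1, …, 1) ∈ ℝᵈ`. -/
noncomputable def massMatrix (N : DampedNetwork d n m) :
    Matrix ((Fin n ⊕ Fin m) × Fin d) ((Fin n ⊕ Fin m) × Fin d) ℝ :=
  Matrix.diagonal fun a => N.mass a.1

/-- The damping matrix `C`: the contributions of the dashpots and of the viscous cavities. -/
noncomputable def dampingMatrix (N : DampedNetwork d n m) :
    Matrix ((Fin n ⊕ Fin m) × Fin d) ((Fin n ⊕ Fin m) × Fin d) ℝ :=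
  (1 / 2 : ℝ) • (∑ i, ∑ j, N.dashpot i j • N.bondMatrix i j) +
    Matrix.diagonal fun a => N.cavity a.1

/-- Rayleigh damping: each dashpot has `α` times the constant of its spring, and each cavity has
`β` times the mass it surrounds. -/
def IsRayleigh (N : DampedNetwork d n m) (α β : ℝ) : Prop :=
  (∀ i j, N.dashpot i j = α * N.spring i j) ∧ ∀ i, N.cavity i = β * N.mass i

/-- Rayleigh damping in matrix form: `C = α K + β M`. -/
theorem IsRayleigh.dampingMatrix_eq {N : DampedNetwork d n m} {α β : ℝ}
    (h : N.IsRayleigh α β) :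
    N.dampingMatrix = α • N.stiffnessMatrix + β • N.massMatrix := by
  ext a b
  simp only [dampingMatrix, stiffnessMatrix, massMatrix, h.1, h.2, Matrix.add_apply,
    Matrix.smul_apply, Matrix.sum_apply, smul_eq_mul, Matrix.diagonal_apply, Finset.mul_sum]
  congr 1
  · refine Finset.sum_congr rfl fun i _ => Finset.sum_congr rfl fun j _ => ?_
    ring
  · split_ifs <;> simp

/-- The matrix `K + z C + z² M` of Newton's second law at the Laplace parameter `z`. -/
noncomputable def dynamicMatrix (N : DampedNetwork d n m) (z : ℂ) :
    Matrix ((Fin n ⊕ Fin m) × Fin d) ((Fin n ⊕ Fin m) × Fin d) ℂ :=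
  N.stiffnessMatrix.map Complex.ofReal + z • N.dampingMatrix.map Complex.ofReal +
    z ^ 2 • N.massMatrix.map Complex.ofReal

/-- `W` is the displacement-to-forces map of the network at the Laplace parameter `z`: for every
terminal displacement `uB` there are node displacements `u` that extend it and leave no external
force at the internal nodes, and for all such `u` the terminal forces are `W uB`.  Where the
internal block of `K + z C + z² M` is invertible, this says that `W` is its Schur complement;
floppy or massless internal nodes, for which `u` need not be unique, are covered too. -/
def IsResponseAt (N : DampedNetwork d n m) (z : ℂ)
    (W : Matrix (Fin n × Fin d) (Fin n × Fin d) ℂ) : Prop :=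
  ∀ uB : Fin n × Fin d → ℂ, ∀ fB : Fin n × Fin d → ℂ,
    (∃ u : (Fin n ⊕ Fin m) × Fin d → ℂ,
      (∀ i s, u (Sum.inl i, s) = uB (i, s)) ∧
      (∀ i s, (N.dynamicMatrix z).mulVec u (Sum.inl i, s) = fB (i, s)) ∧
      (∀ l s, (N.dynamicMatrix z).mulVec u (Sum.inr l, s) = 0)) ↔
    fB = W.mulVec uB

end DampedNetwork

/-- The forces `fᵢ` applied at the points `xᵢ` form a balanced system: `∑ fᵢ = 0` and
`∑ xᵢ × fᵢ = 0`.  The cross product is written through its components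
`xᵢ,ₛ fᵢ,ₜ - xᵢ,ₜ fᵢ,ₛ`, which are the usual ones both for `d = 2` and for `d = 3`. -/
def IsBalanced {d n : ℕ} (x : Fin n → EuclideanSpace ℝ (Fin d)) (f : Fin n × Fin d → ℝ) : Prop :=
  (∀ s, ∑ i, f (i, s) = 0) ∧ ∀ s t, ∑ i, (x i s * f (i, t) - x i t * f (i, s)) = 0

/-- The polynomial `q(z) = σ + z (α σ + β) + z²`. -/
noncomputable def resonancePoly (α β σ : ℝ) (z : ℂ) : ℂ :=
  (σ : ℂ) + z * ((α : ℂ) * (σ : ℂ) + (β : ℂ)) + z ^ 2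

/-- The matrix function
`(1 + α z) A + (β z + z²) M - ∑ⱼ (1 + α z)² R⁽ʲ⁾ / (σⱼ + z (α σⱼ + β) + z²)`. -/
noncomputable def rationalResponse {ι : Type*} {p : ℕ} (α β : ℝ) (A M : Matrix ι ι ℝ)
    (σ : Fin p → ℝ) (R : Fin p → Matrix ι ι ℝ) (z : ℂ) : Matrix ι ι ℂ :=
  (1 + (α : ℂ) * z) • A.map Complex.ofReal +
    ((β : ℂ) * z + z ^ 2) • M.map Complex.ofReal -
    ∑ j, ((1 + (α : ℂ) * z) ^ 2 / resonancePoly α β (σ j) z) • (R j).map Complex.ofReal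

/-! Put s = 1 + αλ and w = βλ + λ². A Rayleigh damped network has dynamic matrix sK + wM_net, and
partial fractions give W(λ) = s W(0) + w M + ∑ⱼ s w / (σⱼ(sσⱼ + w)) R⁽ʲ⁾. Networks that share only
their terminals have additive responses (`Synthesizable.add`). Every construction can therefore be
asked to avoid any prescribed finite set of points, so that internal nodes never collide. The term w
M consists of masses at the terminals, and Gram factorizations of W(0) and of the R⁽ʲ⁾ reduce the
rest to rank-one responses f fᵀ.

Static terms: the Gram rows of W(0) are balanced (`isBalanced_of_gram`), and s f fᵀ is realizable
for every balanced f (`supported_of_balanced`). The engine is `supported_of_sum`: if f = ∑ ℓⱼ, each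
ℓⱼ ℓⱼᵀ is realizable, and equilibrium at fresh nodes forces all ℓⱼ to carry the same tension, then
eliminating these nodes leaves a multiple of f fᵀ. A small triangle ties two bars with a common end
so that their tensions keep a fixed ratio (`supported_three`, `supported_path`). Chaining such ties
realizes every combination of bars (`supported_of_mem_span`). By duality with infinitesimal rigid
motions, every balanced f is such a combination once an orthogonal frame of unloaded nodes is added
(`mem_span_bar_of_balanced`).

Dynamic terms: r need not be balanced. Fresh nodes carrying masses take up the opposite loads g, so
that r + g is a combination of bars, and eliminating the massive nodes produces exactly s w / (σ(sσ
+ w)) r rᵀ (`condenses_resonance`). -/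

/-- Degrees of freedom: a point of space together with a coordinate direction. -/
abbrev Dof (d : ℕ) := EuclideanSpace ℝ (Fin d) × Fin d

/-! ### Force maps on displacement fields and elimination of nodes. -/

namespace Dof

variable {d : ℕ}

/-- The work of a finite system of forces against a displacement field. -/
noncomputable def work (f : Dof d →₀ ℝ) (u : Dof d → ℂ) : ℂ := Finsupp.linearCombination ℝ u f

/-- The force map of a device that resists only the single generalized displacement `work f`. -/
noncomputable def rankOne (f : Dof d →₀ ℝ) (u : Dof d → ℂ) : Dof d → ℂ :=
  fun a => work f u * (f a : ℂ)

/-- The force `v` applied at the point `p`. -/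
noncomputable def load (p v : EuclideanSpace ℝ (Fin d)) : Dof d →₀ ℝ :=
  ∑ k, Finsupp.single (p, k) (v k)

/-- The forces exerted by a bar joining `p` and `q` at unit force density. -/
noncomputable def bar (p q : EuclideanSpace ℝ (Fin d)) : Dof d →₀ ℝ :=
  load p (p - q) - load q (p - q)

theorem work_add (f g : Dof d →₀ ℝ) (u : Dof d → ℂ) : work (f + g) u = work f u + work g u := by
  simp [work]

theorem work_sum {ι : Type*} (s : Finset ι) (f : ι → Dof d →₀ ℝ) (u : Dof d → ℂ) :
    work (∑ i ∈ s, f i) u = ∑ i ∈ s, work (f i) u := by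
  simp [work]

theorem work_smul (r : ℝ) (f : Dof d →₀ ℝ) (u : Dof d → ℂ) :
    work (r • f) u = (r : ℂ) * work f u := by
  simp [work]

theorem work_eq_sum (f : Dof d →₀ ℝ) (u : Dof d → ℂ) :
    work f u = ∑ a ∈ f.support, (f a : ℂ) * u a := by
  simp [work, Finsupp.linearCombination_apply, Finsupp.sum]

theorem work_add_right (f : Dof d →₀ ℝ) (u v : Dof d → ℂ) :
    work f (u + v) = work f u + work f v := by
  simp [work_eq_sum, mul_add, Finset.sum_add_distrib]

theorem work_smul_right (f : Dof d →₀ ℝ) (r : ℂ) (u : Dof d → ℂ) :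
    work f (r • u) = r * work f u := by
  simp [work_eq_sum, Finset.mul_sum, mul_left_comm]

theorem work_congr {f : Dof d →₀ ℝ} {u v : Dof d → ℂ} (h : ∀ a, f a ≠ 0 → u a = v a) :
    work f u = work f v := by
  rw [work_eq_sum, work_eq_sum]
  refine Finset.sum_congr rfl fun a ha => ?_
  rw [h a (Finsupp.mem_support_iff.mp ha)]

theorem work_piSingle [DecidableEq (Dof d)] (f : Dof d →₀ ℝ) (a : Dof d) (r : ℂ) :
    work f (Pi.single a r) = (f a : ℂ) * r := by
  rw [work_eq_sum, Finset.sum_eq_single a]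
  · simp
  · intro b _ hb
    simp [hb]
  · intro ha
    simp [Finsupp.notMem_support_iff.mp ha]

theorem rankOne_smul (r : ℝ) (f : Dof d →₀ ℝ) (u : Dof d → ℂ) (a : Dof d) :
    rankOne (r • f) u a = (r : ℂ) ^ 2 * rankOne f u a := by
  simp only [rankOne, work_smul, Finsupp.smul_apply, smul_eq_mul]
  push_cast
  ring

theorem load_apply_same (p v : EuclideanSpace ℝ (Fin d)) (k : Fin d) : load p v (p, k) = v k := by
  classical
  simp [load, Finsupp.finsetSum_apply, Finsupp.single_apply]

theorem load_apply_of_ne {p q : EuclideanSpace ℝ (Fin d)} (h : q ≠ p)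
    (v : EuclideanSpace ℝ (Fin d)) (k : Fin d) : load p v (q, k) = 0 := by
  classical
  simp [load, Finsupp.finsetSum_apply, h.symm]

theorem load_add (p v w : EuclideanSpace ℝ (Fin d)) : load p (v + w) = load p v + load p w := by
  simp [load, Finset.sum_add_distrib]

theorem load_smul (p : EuclideanSpace ℝ (Fin d)) (r : ℝ) (v : EuclideanSpace ℝ (Fin d)) :
    load p (r • v) = r • load p v := by
  simp [load, Finset.smul_sum]

theorem load_neg (p v : EuclideanSpace ℝ (Fin d)) : load p (-v) = -load p v := by
  simp [load]

theorem load_sub (p v w : EuclideanSpace ℝ (Fin d)) : load p (v - w) = load p v - load p w := by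
  rw [sub_eq_add_neg, load_add, load_neg, sub_eq_add_neg]

theorem load_zero (p : EuclideanSpace ℝ (Fin d)) : load p 0 = 0 := by
  simp [load]

theorem bar_comm (p q : EuclideanSpace ℝ (Fin d)) : bar p q = bar q p := by
  rw [bar, bar, ← neg_sub p q, load_neg, load_neg]
  abel

theorem bar_apply_left {p q : EuclideanSpace ℝ (Fin d)} (h : p ≠ q) (k : Fin d) :
    bar p q (p, k) = p k - q k := by
  simp [bar, load_apply_same, load_apply_of_ne h]

theorem bar_apply_right {p q : EuclideanSpace ℝ (Fin d)} (h : p ≠ q) (k : Fin d) :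
    bar p q (q, k) = q k - p k := by
  rw [bar_comm, bar_apply_left h.symm]

theorem bar_apply_of_ne {p q x : EuclideanSpace ℝ (Fin d)} (hp : x ≠ p) (hq : x ≠ q)
    (k : Fin d) : bar p q (x, k) = 0 := by
  simp [bar, load_apply_of_ne hp, load_apply_of_ne hq]

/-- A map on displacement fields only sees, and only loads, the points of `T`. -/
def LocalOn (T : Set (EuclideanSpace ℝ (Fin d))) (Φ : (Dof d → ℂ) → Dof d → ℂ) : Prop :=
  (∀ u v, (∀ a : Dof d, a.1 ∈ T → u a = v a) → Φ u = Φ v) ∧ ∀ u a, a.1 ∉ T → Φ u a = 0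

theorem LocalOn.mono {T T' : Set (EuclideanSpace ℝ (Fin d))} {Φ : (Dof d → ℂ) → Dof d → ℂ}
    (h : LocalOn T Φ) (hT : T ⊆ T') : LocalOn T' Φ :=
  ⟨fun u v huv => h.1 u v fun a ha => huv a (hT ha), fun u a ha => h.2 u a fun h' => ha (hT h')⟩

theorem LocalOn.add {T : Set (EuclideanSpace ℝ (Fin d))} {Φ Ψ : (Dof d → ℂ) → Dof d → ℂ}
    (h : LocalOn T Φ) (h' : LocalOn T Ψ) : LocalOn T (Φ + Ψ) :=
  ⟨fun u v huv => by simp [h.1 u v huv, h'.1 u v huv],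
    fun u a ha => by simp [h.2 u a ha, h'.2 u a ha]⟩

theorem LocalOn.smul {T : Set (EuclideanSpace ℝ (Fin d))} {Φ : (Dof d → ℂ) → Dof d → ℂ}
    (h : LocalOn T Φ) (c : ℂ) : LocalOn T (c • Φ) :=
  ⟨fun u v huv => by simp [h.1 u v huv], fun u a ha => by simp [h.2 u a ha]⟩

theorem localOn_rankOne {T : Set (EuclideanSpace ℝ (Fin d))} {f : Dof d →₀ ℝ}
    (hf : ∀ a, f a ≠ 0 → a.1 ∈ T) : LocalOn T (rankOne f) := by
  refine ⟨fun u v huv => ?_, fun u a ha => ?_⟩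
  · funext a
    rw [rankOne, rankOne, work_congr fun a ha => huv a (hf a ha)]
  · have : f a = 0 := by
      by_contra h
      exact ha (hf a h)
    simp [rankOne, this]

/-- Eliminating the points of `I`, where no external force acts, turns the force map `F` into
the force map `Φ`. -/
def Condenses (F : (Dof d → ℂ) → Dof d → ℂ) (I : Set (EuclideanSpace ℝ (Fin d)))
    (Φ : (Dof d → ℂ) → Dof d → ℂ) : Prop :=
  (∀ u₀ : Dof d → ℂ, ∃ u, (∀ a, a.1 ∉ I → u a = u₀ a) ∧ F u = Φ u₀) ∧
    ∀ u, (∀ a, a.1 ∈ I → F u a = 0) → F u = Φ u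

theorem Condenses.refl_of_forall {F : (Dof d → ℂ) → Dof d → ℂ}
    (I : Set (EuclideanSpace ℝ (Fin d))) : Condenses F I F :=
  ⟨fun u => ⟨u, fun _ _ => rfl, rfl⟩, fun _ _ => rfl⟩

theorem Condenses.trans {F Φ Ψ : (Dof d → ℂ) → Dof d → ℂ} {I J : Set (EuclideanSpace ℝ (Fin d))}
    (h : Condenses F I Φ) (h' : Condenses Φ J Ψ) : Condenses F (I ∪ J) Ψ := by
  refine ⟨fun u₀ => ?_, fun u hu => ?_⟩
  · obtain ⟨u₁, h₁, e₁⟩ := h'.1 u₀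
    obtain ⟨u₂, h₂, e₂⟩ := h.1 u₁
    refine ⟨u₂, fun a ha => ?_, e₂.trans e₁⟩
    rw [h₂ a fun hI => ha (Or.inl hI), h₁ a fun hJ => ha (Or.inr hJ)]
  · have e := h.2 u fun a ha => hu a (Or.inl ha)
    rw [e]
    refine h'.2 u fun a ha => ?_
    rw [← e]
    exact hu a (Or.inr ha)

/-- Devices that do not touch the eliminated points act there neither by force nor by displacement,
so they commute with elimination. -/
theorem Condenses.add_local {F Φ G : (Dof d → ℂ) → Dof d → ℂ}
    {I T : Set (EuclideanSpace ℝ (Fin d))} (h : Condenses F I Φ) (hG : LocalOn T G)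
    (hT : Disjoint T I) : Condenses (F + G) I (Φ + G) := by
  refine ⟨fun u₀ => ?_, fun u hu => ?_⟩
  · obtain ⟨u, hu, e⟩ := h.1 u₀
    refine ⟨u, hu, ?_⟩
    rw [Pi.add_apply, Pi.add_apply, e,
      hG.1 u u₀ fun a ha => hu a (Set.disjoint_left.mp hT ha)]
  · rw [Pi.add_apply, Pi.add_apply, h.2 u fun a ha => ?_]
    have := hu a ha
    rwa [Pi.add_apply, Pi.add_apply, hG.2 u a (Set.disjoint_right.mp hT ha), add_zero] at this

theorem Condenses.smul {F Φ : (Dof d → ℂ) → Dof d → ℂ} {I : Set (EuclideanSpace ℝ (Fin d))}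
    (h : Condenses F I Φ) (c : ℂ) : Condenses (c • F) I (c • Φ) := by
  refine ⟨fun u₀ => ?_, fun u hu => ?_⟩
  · obtain ⟨u, hu, e⟩ := h.1 u₀
    exact ⟨u, hu, by simp [e]⟩
  · rcases eq_or_ne c 0 with rfl | hc
    · simp
    · rw [Pi.smul_apply, Pi.smul_apply, h.2 u fun a ha => ?_]
      simpa [hc] using hu a ha

/-! ### Spring-mass networks and the calculus of synthesizable responses. -/

/-- The forces exerted by a family of springs; `k (p, q)` is the force density constant of the
spring joining `p` and `q`. -/
noncomputable def springForce
    (k : EuclideanSpace ℝ (Fin d) × EuclideanSpace ℝ (Fin d) →₀ ℝ) (u : Dof d → ℂ) : Dof d → ℂ :=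
  fun a => k.sum fun e κ => (κ : ℂ) * rankOne (bar e.1 e.2) u a

/-- The forces in a Rayleigh damped network of springs `k` and masses `μ`, at the value `z.1` of
`1 + α λ` and the value `z.2` of `β λ + λ²`. -/
noncomputable def netForce (k : EuclideanSpace ℝ (Fin d) × EuclideanSpace ℝ (Fin d) →₀ ℝ)
    (μ : EuclideanSpace ℝ (Fin d) → ℝ) (z : ℂ × ℂ) (u : Dof d → ℂ) : Dof d → ℂ :=
  fun a => z.1 * springForce k u a + z.2 * ((μ a.1 : ℂ) * u a)

theorem springForce_add (k l : EuclideanSpace ℝ (Fin d) × EuclideanSpace ℝ (Fin d) →₀ ℝ)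
    (u : Dof d → ℂ) (a : Dof d) :
    springForce (k + l) u a = springForce k u a + springForce l u a := by
  classical
  rw [springForce, Finsupp.sum_add_index'] <;> simp [springForce, add_mul]

theorem springForce_smul (c : ℝ) (k : EuclideanSpace ℝ (Fin d) × EuclideanSpace ℝ (Fin d) →₀ ℝ)
    (u : Dof d → ℂ) (a : Dof d) : springForce (c • k) u a = c * springForce k u a := by
  rw [springForce, Finsupp.sum_smul_index (by simp), springForce, Finsupp.mul_sum]
  refine Finsupp.sum_congr fun e _ => ?_
  push_cast
  ring

theorem netForce_add (k l : EuclideanSpace ℝ (Fin d) × EuclideanSpace ℝ (Fin d) →₀ ℝ)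
    (μ ν : EuclideanSpace ℝ (Fin d) → ℝ) (z : ℂ × ℂ) :
    netForce (k + l) (μ + ν) z = netForce k μ z + netForce l ν z := by
  funext u a
  simp only [netForce, springForce_add, Pi.add_apply]
  push_cast
  ring

theorem netForce_smul (c : ℝ) (k : EuclideanSpace ℝ (Fin d) × EuclideanSpace ℝ (Fin d) →₀ ℝ)
    (μ : EuclideanSpace ℝ (Fin d) → ℝ) (z : ℂ × ℂ) :
    netForce (c • k) (c • μ) z = (c : ℂ) • netForce k μ z := by
  funext u a
  simp only [netForce, springForce_smul, Pi.smul_apply, smul_eq_mul]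
  push_cast
  ring

theorem bar_apply_ne_zero {p q : EuclideanSpace ℝ (Fin d)} {a : Dof d} (h : bar p q a ≠ 0) :
    a.1 = p ∨ a.1 = q := by
  by_contra! hc
  exact h (bar_apply_of_ne hc.1 hc.2 a.2)

theorem localOn_netForce {T : Set (EuclideanSpace ℝ (Fin d))}
    {k : EuclideanSpace ℝ (Fin d) × EuclideanSpace ℝ (Fin d) →₀ ℝ}
    {μ : EuclideanSpace ℝ (Fin d) → ℝ} (hk : ∀ p q, k (p, q) ≠ 0 → p ∈ T ∧ q ∈ T)
    (hμ : ∀ p, p ∉ T → μ p = 0) (z : ℂ × ℂ) : LocalOn T (netForce k μ z) := by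
  have hbar : ∀ e ∈ k.support, LocalOn T (rankOne (bar e.1 e.2)) := fun e he => by
    obtain ⟨h1, h2⟩ := hk e.1 e.2 (Finsupp.mem_support_iff.mp he)
    refine localOn_rankOne fun a ha => ?_
    rcases bar_apply_ne_zero ha with h | h <;> rwa [h]
  refine ⟨fun u v huv => ?_, fun u a ha => ?_⟩
  · funext a
    have h1 : springForce k u a = springForce k v a :=
      Finset.sum_congr rfl fun e he => by simp only [(hbar e he).1 u v huv]
    have h2 : (μ a.1 : ℂ) * u a = (μ a.1 : ℂ) * v a := by
      by_cases ha : a.1 ∈ T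
      · rw [huv a ha]
      · simp [hμ _ ha]
    rw [netForce, netForce, h1, h2]
  · have h1 : springForce k u a = 0 :=
      Finset.sum_eq_zero fun e he => by simp [(hbar e he).2 u a ha]
    simp [netForce, h1, hμ _ ha]

/-- For every finite set `S` there is a network with terminals `T`, internal nodes in `U \ S` and
the response `Φ` for all parameters in `D`. -/
def Synthesizable (U : Set (EuclideanSpace ℝ (Fin d))) (D : Set (ℂ × ℂ))
    (T : Set (EuclideanSpace ℝ (Fin d))) (Φ : ℂ × ℂ → (Dof d → ℂ) → Dof d → ℂ) : Prop :=
  (∀ z, LocalOn T (Φ z)) ∧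
  ∀ S : Set (EuclideanSpace ℝ (Fin d)), S.Finite →
    ∃ (I : Set (EuclideanSpace ℝ (Fin d)))
      (k : EuclideanSpace ℝ (Fin d) × EuclideanSpace ℝ (Fin d) →₀ ℝ)
      (μ : EuclideanSpace ℝ (Fin d) → ℝ),
      I.Finite ∧ I ⊆ U ∧ Disjoint S I ∧ Disjoint T I ∧
      (∀ e, 0 ≤ k e) ∧ (∀ p q, k (p, q) ≠ 0 → p ∈ T ∪ I ∧ q ∈ T ∪ I) ∧
      (∀ p, 0 ≤ μ p) ∧ (∀ p, p ∉ T ∪ I → μ p = 0) ∧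
      ∀ z ∈ D, Condenses (netForce k μ z) I (Φ z)

variable {U : Set (EuclideanSpace ℝ (Fin d))} {D : Set (ℂ × ℂ)}
  {T : Set (EuclideanSpace ℝ (Fin d))}

theorem synthesizable_zero : Synthesizable U D T 0 := by
  refine ⟨fun z => ⟨fun _ _ _ => rfl, fun _ _ _ => rfl⟩, fun S _ => ⟨∅, 0, 0, by simp, by simp,
    by simp, by simp, by simp, by simp, by simp, by simp, fun z _ => ?_⟩⟩
  have : netForce 0 0 z = (0 : (Dof d → ℂ) → Dof d → ℂ) := by
    funext u a
    simp [netForce, springForce]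
  rw [this]
  exact Condenses.refl_of_forall _

/-- Parallel connection. The second network avoids the internal nodes of the first, so the two sets
of internal nodes can be eliminated one after the other. -/
theorem Synthesizable.add {Φ Ψ : ℂ × ℂ → (Dof d → ℂ) → Dof d → ℂ} (h : Synthesizable U D T Φ)
    (h' : Synthesizable U D T Ψ) : Synthesizable U D T (Φ + Ψ) := by
  refine ⟨fun z => (h.1 z).add (h'.1 z), fun S hS => ?_⟩
  obtain ⟨I, k, μ, hI, hIU, hSI, hTI, hk, hkI, hμ, hμI, hc⟩ := h.2 S hS
  obtain ⟨J, l, ν, hJ, hJU, hSJ, hTJ, hl, hlJ, hν, hνJ, hc'⟩ := h'.2 (S ∪ I) (hS.union hI)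
  have hIJ : Disjoint I J := hSJ.mono_left Set.subset_union_right
  refine ⟨I ∪ J, k + l, μ + ν, hI.union hJ, Set.union_subset hIU hJU,
    hSI.union_right (hSJ.mono_left Set.subset_union_left), hTI.union_right hTJ,
    fun e => add_nonneg (hk e) (hl e), fun p q hpq => ?_, fun p => add_nonneg (hμ p) (hν p),
    fun p hp => ?_, fun z hz => ?_⟩
  · have : k (p, q) ≠ 0 ∨ l (p, q) ≠ 0 := by
      by_contra! h0
      exact hpq (by simp [h0.1, h0.2])
    rcases this with h1 | h1
    · have := hkI p q h1
      simp only [Set.mem_union] at this ⊢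
      tauto
    · have := hlJ p q h1
      simp only [Set.mem_union] at this ⊢
      tauto
  · simp only [Set.mem_union, not_or] at hp
    simp [hμI p (by simp [hp]), hνJ p (by simp [hp])]
  · rw [netForce_add]
    have h1 : Condenses (netForce k μ z + netForce l ν z) I (Φ z + netForce l ν z) :=
      (hc z hz).add_local (localOn_netForce hlJ hνJ z) (hTI.union_left hIJ.symm)
    have h2 : Condenses (netForce l ν z + Φ z) J (Ψ z + Φ z) :=
      (hc' z hz).add_local (h.1 z) hTJ
    rw [add_comm (netForce l ν z), add_comm (Ψ z)] at h2
    exact h1.trans h2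

theorem Synthesizable.sum {ι : Type*} (s : Finset ι)
    {Φ : ι → ℂ × ℂ → (Dof d → ℂ) → Dof d → ℂ}
    (h : ∀ i ∈ s, Synthesizable U D T (Φ i)) : Synthesizable U D T (∑ i ∈ s, Φ i) := by
  classical
  induction s using Finset.induction_on with
  | empty => simpa using synthesizable_zero
  | insert i s hi ih =>
    rw [Finset.sum_insert hi]
    exact (h i (by simp)).add (ih fun j hj => h j (by simp [hj]))

theorem Synthesizable.smul {Φ : ℂ × ℂ → (Dof d → ℂ) → Dof d → ℂ} (h : Synthesizable U D T Φ)
    {c : ℝ} (hc : 0 ≤ c) : Synthesizable U D T ((c : ℂ) • Φ) := by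
  refine ⟨fun z => (h.1 z).smul c, fun S hS => ?_⟩
  obtain ⟨I, k, μ, hI, hIU, hSI, hTI, hk, hkI, hμ, hμI, hcond⟩ := h.2 S hS
  refine ⟨I, c • k, c • μ, hI, hIU, hSI, hTI, fun e => mul_nonneg hc (hk e),
    fun p q hpq => hkI p q fun h0 => hpq (by simp [h0]), fun p => mul_nonneg hc (hμ p),
    fun p hp => by simp [hμI p hp], fun z hz => ?_⟩
  rw [netForce_smul]
  exact (hcond z hz).smul c

theorem Synthesizable.mono {Φ : ℂ × ℂ → (Dof d → ℂ) → Dof d → ℂ} (h : Synthesizable U D T Φ)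
    {T' : Set (EuclideanSpace ℝ (Fin d))} (hT : T ⊆ T') (hT' : T'.Finite) :
    Synthesizable U D T' Φ := by
  refine ⟨fun z => (h.1 z).mono hT, fun S hS => ?_⟩
  -- The internal nodes must also keep clear of the new terminals; this is where finiteness of `T'`
  -- enters.
  obtain ⟨I, k, μ, hI, hIU, hSI, hTI, hk, hkI, hμ, hμI, hcond⟩ := h.2 (S ∪ T') (hS.union hT')
  have hs : T ∪ I ⊆ T' ∪ I := Set.union_subset_union_left _ hT
  exact ⟨I, k, μ, hI, hIU, hSI.mono_left Set.subset_union_left,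
    hSI.mono_left Set.subset_union_right, hk,
    fun p q hpq => ⟨hs (hkI p q hpq).1, hs (hkI p q hpq).2⟩, hμ,
    fun p hp => hμI p fun h' => hp (hs h'), hcond⟩

/-- Condensation of further nodes, which may be chosen depending on the set to be avoided. -/
theorem synthesizable_of_condenses {Ψ : ℂ × ℂ → (Dof d → ℂ) → Dof d → ℂ}
    (hΨ : ∀ z, LocalOn T (Ψ z))
    (h : ∀ S : Set (EuclideanSpace ℝ (Fin d)), S.Finite → ∃ J Φ, J.Finite ∧ J ⊆ U ∧
      Disjoint S J ∧ Disjoint T J ∧ Synthesizable U D (T ∪ J) Φ ∧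
      ∀ z ∈ D, Condenses (Φ z) J (Ψ z)) : Synthesizable U D T Ψ := by
  refine ⟨hΨ, fun S hS => ?_⟩
  obtain ⟨J, Φ, hJ, hJU, hSJ, hTJ, hs, hcJ⟩ := h S hS
  obtain ⟨I, k, μ, hI, hIU, hSI, hTI, hk, hkI, hμ, hμI, hcond⟩ := hs.2 S hS
  have e : T ∪ J ∪ I = T ∪ (I ∪ J) := by
    rw [Set.union_assoc, Set.union_comm J]
  rw [e] at hkI hμI
  exact ⟨I ∪ J, k, μ, hI.union hJ, Set.union_subset hIU hJU, hSI.union_right hSJ,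
    (hTI.mono_left Set.subset_union_left).union_right hTJ, hk, hkI, hμ, hμI,
    fun z hz => (hcond z hz).trans (hcJ z hz)⟩

theorem synthesizable_mass {μ : EuclideanSpace ℝ (Fin d) → ℝ} (hμ : ∀ p, 0 ≤ μ p)
    (hμT : ∀ p, p ∉ T → μ p = 0) :
    Synthesizable U D T fun z u a => z.2 * ((μ a.1 : ℂ) * u a) := by
  have e : (fun (z : ℂ × ℂ) (u : Dof d → ℂ) (a : Dof d) => z.2 * ((μ a.1 : ℂ) * u a)) =
      netForce 0 μ := by
    funext z u a
    simp [netForce, springForce]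
  rw [e]
  refine ⟨fun z => localOn_netForce (by simp) hμT z, fun S _ => ⟨∅, 0, μ, by simp, by simp,
    by simp, by simp, by simp, by simp, hμ, by simpa using hμT, fun z _ => ?_⟩⟩
  exact Condenses.refl_of_forall _

/-- The system of forces `f` spans the static response of some network with terminals `T`. -/
def Supported (U : Set (EuclideanSpace ℝ (Fin d))) (D : Set (ℂ × ℂ))
    (T : Set (EuclideanSpace ℝ (Fin d))) (f : Dof d →₀ ℝ) : Prop :=
  Synthesizable U D T fun z => z.1 • rankOne f

theorem supported_bar {p q : EuclideanSpace ℝ (Fin d)} (hp : p ∈ T) (hq : q ∈ T) :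
    Supported U D T (bar p q) := by
  have e : (fun z : ℂ × ℂ => z.1 • rankOne (bar p q)) =
      netForce (Finsupp.single (p, q) 1) 0 := by
    funext z u a
    simp [netForce, springForce]
  rw [Supported, e]
  have hk : ∀ p' q', (Finsupp.single (p, q) (1 : ℝ)) (p', q') ≠ 0 → p' ∈ T ∧ q' ∈ T := by
    classical
    intro p' q' h
    rw [Finsupp.single_apply] at h
    simp only [Prod.mk.injEq, ne_eq, ite_eq_right_iff, one_ne_zero, imp_false, not_not] at h
    exact ⟨h.1 ▸ hp, h.2 ▸ hq⟩
  refine ⟨fun z => localOn_netForce hk (by simp) z, fun S _ => ⟨∅, Finsupp.single (p, q) 1, 0,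
    by simp, by simp, by simp, by simp, fun e => ?_, by simpa using hk, by simp, by simp,
    fun z _ => Condenses.refl_of_forall _⟩⟩
  classical
  rw [Finsupp.single_apply]
  split_ifs <;> norm_num

/-- The response is quadratic in `f`, so the scale becomes r² ≥ 0 and the sign of `r` is free. Bars
may thus enter combinations with negative coefficients although spring constants are nonnegative. -/
theorem Supported.smul {f : Dof d →₀ ℝ} (h : Supported U D T f) (r : ℝ) :
    Supported U D T (r • f) := by
  have := Synthesizable.smul h (sq_nonneg r)
  rw [Supported]
  convert this using 1
  funext z u a
  simp only [Pi.smul_apply, smul_eq_mul, rankOne_smul]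
  push_cast
  ring

theorem Supported.mono {f : Dof d →₀ ℝ} (h : Supported U D T f)
    {T' : Set (EuclideanSpace ℝ (Fin d))} (hT : T ⊆ T') (hT' : T'.Finite) :
    Supported U D T' f := Synthesizable.mono h hT hT'

end Dof

/-! ### Combining rank-one responses through fresh nodes. -/

namespace Dof

variable {d : ℕ} {U : Set (EuclideanSpace ℝ (Fin d))} {D : Set (ℂ × ℂ)}
  {T : Set (EuclideanSpace ℝ (Fin d))}

/-- Condensing a sum of rank-one responses whose only self-balanced combination at the points of
`J` is the plain sum. -/
theorem condenses_sum_rankOne {N : ℕ} {ℓ : Fin N → Dof d →₀ ℝ} {f : Dof d →₀ ℝ}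
    {J : Set (EuclideanSpace ℝ (Fin d))} (hN : N ≠ 0) (hsum : ∑ j, ℓ j = f)
    (hfJ : ∀ a, a.1 ∈ J → f a = 0)
    (huniq : ∀ τ : Fin N → ℂ, (∀ a, a.1 ∈ J → ∑ j, τ j * (ℓ j a : ℂ) = 0) → ∀ i j, τ i = τ j) :
    Condenses (∑ j, rankOne (ℓ j)) J (((N : ℂ)⁻¹) • rankOne f) := by
  classical
  have hN' : (N : ℂ) ≠ 0 := by exact_mod_cast hN
  have hwork : ∀ u, work f u = ∑ j, work (ℓ j) u := fun u => by rw [← hsum, work_sum]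
  have hall : ∀ (u : Dof d → ℂ) (t : ℂ), (∀ j, work (ℓ j) u = t) →
      (∑ j, rankOne (ℓ j)) u = (((N : ℂ)⁻¹) • rankOne f) u := by
    intro u t ht
    have h1 : work f u = N * t := by simp [hwork, ht]
    funext a
    have h2 : (f a : ℂ) = ∑ j, (ℓ j a : ℂ) := by
      rw [← hsum, Finsupp.finsetSum_apply]
      push_cast
      rfl
    simp only [Finset.sum_apply, rankOne, Pi.smul_apply, smul_eq_mul, h1, h2, ht]
    rw [← Finset.mul_sum]
    field_simp
  refine ⟨fun u₀ => ?_, fun u hu => ?_⟩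
  · -- the attainable work vectors exhaust the vectors of zero sum
    let L : (Dof d → ℂ) →ₗ[ℂ] (Fin N → ℂ) :=
      { toFun := fun u j => work (ℓ j) u
        map_add' := fun u v => funext fun j => work_add_right _ _ _
        map_smul' := fun r u => funext fun j => work_smul_right _ _ _ }
    let V : Submodule ℂ (Dof d → ℂ) :=
      { carrier := {v | ∀ a, a.1 ∉ J → v a = 0}
        add_mem' := fun {v w} hv hw a ha => by simp [hv a ha, hw a ha]
        zero_mem' := fun _ _ => rfl
        smul_mem' := fun r v hv a ha => by simp [hv a ha] }
    -- The change of each work needed to bring them all to their common mean.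
    let w : Fin N → ℂ := fun j => (N : ℂ)⁻¹ * work f u₀ - work (ℓ j) u₀
    have hw : ∑ j, w j = 0 := by
      simp only [w, Finset.sum_sub_distrib, ← hwork, Finset.sum_const, Finset.card_univ,
        Fintype.card_fin, nsmul_eq_mul]
      field_simp
      simp
    -- Duality: a functional that kills all attainable work vectors is a self-balanced combination
    -- at `J`, so its coefficients are all equal by `huniq`, and it kills the zero-sum vector `w`.
    have hmem : w ∈ V.map L := by
      by_contra hcon
      obtain ⟨φ, hφ, hker⟩ := Submodule.exists_le_ker_of_notMem hcon
      have hφe : ∀ v, φ v = ∑ j, φ (Pi.single j 1) * v j := fun v => by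
        conv_lhs => rw [pi_eq_sum_univ' v]
        simp [mul_comm]
      have hc := huniq (fun j => φ (Pi.single j 1)) fun a ha => by
        have h1 : L (Pi.single a 1) ∈ V.map L := by
          refine Submodule.mem_map_of_mem fun b hb => ?_
          have : b ≠ a := fun h => hb (h ▸ ha)
          simp [this]
        have h2 := hker h1
        rw [LinearMap.mem_ker, hφe] at h2
        simpa [L, work_piSingle] using h2
      apply hφ
      rw [hφe]
      obtain ⟨i⟩ : Nonempty (Fin N) := ⟨⟨0, Nat.pos_of_ne_zero hN⟩⟩
      simp only [fun j => hc j i]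
      rw [← Finset.mul_sum, hw, mul_zero]
    obtain ⟨v, hv, hvw⟩ := hmem
    refine ⟨u₀ + v, fun a ha => by simp [hv a ha], ?_⟩
    have hfv : work f v = 0 := by
      have : work f v = work f 0 := work_congr fun a ha => hv a fun h => ha (hfJ a h)
      rw [this]
      simp [work_eq_sum]
    rw [hall (u₀ + v) ((N : ℂ)⁻¹ * work f u₀) fun j => ?_]
    · funext a
      simp [rankOne, work_add_right, hfv]
    · have := congrFun hvw j
      simp only [L, w, LinearMap.coe_mk, AddHom.coe_mk] at this
      rw [work_add_right, this]
      ring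
  -- Equilibrium at `J` says that the tensions `work (ℓ j) u` form a self-balanced combination,
  -- hence coincide.
  · have h1 := huniq (fun j => work (ℓ j) u) fun a ha => by
      simpa [Finset.sum_apply, rankOne] using hu a ha
    obtain ⟨i⟩ : Nonempty (Fin N) := ⟨⟨0, Nat.pos_of_ne_zero hN⟩⟩
    exact hall u _ fun j => h1 j i

/-- Combination of supported systems of forces through fresh nodes. -/
theorem supported_of_sum {f : Dof d →₀ ℝ} (hf : ∀ a, f a ≠ 0 → a.1 ∈ T)
    (h : ∀ S : Set (EuclideanSpace ℝ (Fin d)), S.Finite →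
      ∃ (J : Set (EuclideanSpace ℝ (Fin d))) (N : ℕ) (ℓ : Fin N → Dof d →₀ ℝ), N ≠ 0 ∧
        J.Finite ∧ J ⊆ U ∧ Disjoint S J ∧ Disjoint T J ∧ (∀ j, Supported U D (T ∪ J) (ℓ j)) ∧
        ∑ j, ℓ j = f ∧
        ∀ τ : Fin N → ℂ, (∀ a, a.1 ∈ J → ∑ j, τ j * (ℓ j a : ℂ) = 0) → ∀ i j, τ i = τ j) :
    Supported U D T f := by
  refine synthesizable_of_condenses (fun z => (localOn_rankOne hf).smul _) fun S hS => ?_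
  obtain ⟨J, N, ℓ, hN, hJ, hJU, hSJ, hTJ, hℓ, hsum, huniq⟩ := h S hS
  -- Stiffening by the factor `N` compensates the factor 1/N left by the elimination.
  refine ⟨J, ((N : ℝ) : ℂ) • ∑ j, fun z => z.1 • rankOne (ℓ j), hJ, hJU, hSJ, hTJ,
    (Synthesizable.sum _ fun j _ => hℓ j).smul (Nat.cast_nonneg N), fun z _ => ?_⟩
  have hc := ((condenses_sum_rankOne hN hsum (fun a ha => ?_) huniq).smul (N : ℂ)).smul z.1
  · have hN' : (N : ℂ) ≠ 0 := by exact_mod_cast hN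
    convert hc using 1
    · funext u a
      simp only [Pi.smul_apply, Finset.sum_apply, smul_eq_mul, Finset.mul_sum]
      refine Finset.sum_congr rfl fun j _ => ?_
      push_cast
      ring
    · rw [smul_smul (N : ℂ), mul_inv_cancel₀ hN', one_smul]
  · by_contra h0
    exact Set.disjoint_left.mp hTJ (hf a h0) ha

/-- Two supported systems of forces that cancel each other at a fresh node. -/
theorem supported_add_of_cancel {f : Dof d →₀ ℝ} (hf : ∀ a, f a ≠ 0 → a.1 ∈ T)
    (h : ∀ S : Set (EuclideanSpace ℝ (Fin d)), S.Finite →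
      ∃ (y : EuclideanSpace ℝ (Fin d)) (g : Dof d →₀ ℝ), y ∈ U ∧ y ∉ S ∧ y ∉ T ∧
        (∃ k, g (y, k) ≠ 0) ∧ Supported U D (insert y T) g ∧
        Supported U D (insert y T) (f - g)) :
    Supported U D T f := by
  refine supported_of_sum hf fun S hS => ?_
  obtain ⟨y, g, hyU, hyS, hyT, ⟨k, hk⟩, hg, hfg⟩ := h S hS
  refine ⟨{y}, 2, ![g, f - g], two_ne_zero, by simp, by simpa using hyU, by simpa using hyS,
    by simpa using hyT, ?_, by simp, fun τ hτ => ?_⟩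
  · rw [Set.union_singleton]
    intro j
    fin_cases j
    exacts [hg, hfg]
  · have h0 : f (y, k) = 0 := by
      by_contra h0
      exact hyT (hf _ h0)
    have h1 := hτ (y, k) rfl
    simp only [Fin.sum_univ_two, Matrix.cons_val_zero, Matrix.cons_val_one, Finsupp.sub_apply,
      h0, zero_sub, Complex.ofReal_neg] at h1
    have h2 : (τ 0 - τ 1) * (g (y, k) : ℂ) = 0 := by linear_combination h1
    have h3 : τ 0 = τ 1 := by
      rcases mul_eq_zero.mp h2 with h | h
      · exact sub_eq_zero.mp h
      · exact absurd (by exact_mod_cast h) hk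
    intro i j
    fin_cases i <;> fin_cases j <;> simp [h3]

/-- Fresh nodes that carry no load may be dropped from the terminals. -/
theorem supported_of_unloaded {f : Dof d →₀ ℝ} (hf : ∀ a, f a ≠ 0 → a.1 ∈ T)
    (h : ∀ S : Set (EuclideanSpace ℝ (Fin d)), S.Finite →
      ∃ J : Set (EuclideanSpace ℝ (Fin d)), J.Finite ∧ J ⊆ U ∧ Disjoint S J ∧ Disjoint T J ∧
        Supported U D (T ∪ J) f) : Supported U D T f := by
  refine synthesizable_of_condenses (fun z => (localOn_rankOne hf).smul _) fun S hS => ?_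
  obtain ⟨J, hJ, hJU, hSJ, hTJ, hs⟩ := h S hS
  exact ⟨J, _, hJ, hJU, hSJ, hTJ, hs, fun z _ => Condenses.refl_of_forall _⟩

/-! ### Generic points -/

/-- For d ≥ 2 lines and finite sets are Lebesgue null, whereas a nonempty open set has positive
measure. -/
theorem exists_generic (hd : 2 ≤ d) (hU : IsOpen U) (hne : U.Nonempty)
    {S : Set (EuclideanSpace ℝ (Fin d))} (hS : S.Finite)
    (L : Fin 3 → EuclideanSpace ℝ (Fin d) × EuclideanSpace ℝ (Fin d)) :
    ∃ w ∈ U, w ∉ S ∧ ∀ i, ∀ r : ℝ, w ≠ (L i).1 + r • (L i).2 := by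
  open MeasureTheory in
  have hline : ∀ i, (volume : Measure (EuclideanSpace ℝ (Fin d)))
      {w | ∃ r : ℝ, w = (L i).1 + r • (L i).2} = 0 := by
    intro i
    have hsub : {w | ∃ r : ℝ, w = (L i).1 + r • (L i).2} ⊆
        (AffineSubspace.mk' (L i).1 (Submodule.span ℝ {(L i).2}) :
          Set (EuclideanSpace ℝ (Fin d))) := by
      rintro w ⟨r, rfl⟩
      simp [AffineSubspace.mem_mk', Submodule.mem_span_singleton]
    refine measure_mono_null hsub (Measure.addHaar_affineSubspace _ _ fun htop => ?_)
    have h1 : Submodule.span ℝ {(L i).2} = ⊤ := by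
      have := congrArg AffineSubspace.direction htop
      simpa using this
    have h2 := finrank_span_le_card (R := ℝ) ({(L i).2} : Set (EuclideanSpace ℝ (Fin d)))
    rw [h1, finrank_top] at h2
    simp at h2
    omega
  have hnull : MeasureTheory.volume (S ∪ ⋃ i, {w | ∃ r : ℝ, w = (L i).1 + r • (L i).2}) = 0 := by
    have : Nonempty (Fin d) := ⟨⟨0, by omega⟩⟩
    rw [MeasureTheory.measure_union_null_iff]
    exact ⟨hS.measure_zero _, MeasureTheory.measure_iUnion_null hline⟩
  obtain ⟨w, hwU, hw⟩ : ∃ w ∈ U,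
      w ∉ S ∪ ⋃ i, {w | ∃ r : ℝ, w = (L i).1 + r • (L i).2} := by
    by_contra! hcon
    exact (hU.measure_pos MeasureTheory.volume hne).ne'
      (MeasureTheory.measure_mono_null hcon hnull)
  simp only [Set.mem_union, Set.mem_iUnion, Set.mem_ofPred_eq, not_or, not_exists] at hw
  exact ⟨w, hwU, hw.1, hw.2⟩

/-- The base point `p` may itself lie in `S`: small positive `τ` stay away from the closed set `S \
{p}`, and `v ≠ 0` keeps the point different from `p`. -/
theorem eventually_fresh (hU : IsOpen U) {p : EuclideanSpace ℝ (Fin d)} (hp : p ∈ U)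
    {S : Set (EuclideanSpace ℝ (Fin d))} (hS : S.Finite) {v : EuclideanSpace ℝ (Fin d)}
    (hv : v ≠ 0) :
    ∀ᶠ τ : ℝ in nhdsWithin 0 (Set.Ioi 0), p + τ • v ∈ U ∧ p + τ • v ∉ S := by
  have hcont : Filter.Tendsto (fun τ : ℝ => p + τ • v) (nhdsWithin 0 (Set.Ioi 0)) (nhds p) := by
    have : Continuous fun τ : ℝ => p + τ • v := by fun_prop
    have h := this.tendsto 0
    simp only [zero_smul, add_zero] at h
    exact h.mono_left nhdsWithin_le_nhds
  have h1 := hcont.eventually (hU.mem_nhds hp)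
  have h2 := hcont.eventually
    ((hS.subset (Set.sdiff_subset (t := {p}))).isClosed.isOpen_compl.mem_nhds (show p ∈ (S \ {p})ᶜ by simp))
  filter_upwards [h1, h2, self_mem_nhdsWithin] with τ h1 h2 h3
  refine ⟨h1, fun hmem => h2 ⟨hmem, fun h => ?_⟩⟩
  have : τ • v = 0 := by simpa using h
  rcases smul_eq_zero.mp this with h | h
  · exact (ne_of_gt h3) h
  · exact hv h

end Dof

/-! ### Realizing combinations of bars. -/

namespace Dof

variable {d : ℕ} {U : Set (EuclideanSpace ℝ (Fin d))} {D : Set (ℂ × ℂ)}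
  {T : Set (EuclideanSpace ℝ (Fin d))}

/-- Real independent vectors remain independent over ℂ; the tensions at a complex Laplace parameter
are complex. -/
theorem eq_zero_of_pair {v w : EuclideanSpace ℝ (Fin d)} (h : LinearIndependent ℝ ![v, w])
    {α β : ℂ} (h0 : ∀ k, α * (v k : ℂ) + β * (w k : ℂ) = 0) : α = 0 ∧ β = 0 := by
  rw [LinearIndependent.pair_iff] at h
  have hre := h α.re β.re (by
    ext k
    simpa using congrArg Complex.re (h0 k))
  have him := h α.im β.im (by
    ext k
    simpa using congrArg Complex.im (h0 k))
  exact ⟨Complex.ext hre.1 him.1, Complex.ext hre.2 him.2⟩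

theorem pair_smul {v w : EuclideanSpace ℝ (Fin d)} (h : LinearIndependent ℝ ![v, w])
    {r s : ℝ} (hr : r ≠ 0) (hs : s ≠ 0) : LinearIndependent ℝ ![r • v, s • w] := by
  rw [LinearIndependent.pair_iff] at h ⊢
  intro a b hab
  have := h (a * r) (b * s) (by rw [mul_smul, mul_smul]; exact hab)
  exact ⟨(mul_eq_zero.mp this.1).resolve_right hr, (mul_eq_zero.mp this.2).resolve_right hs⟩

theorem pair_comb {v w : EuclideanSpace ℝ (Fin d)} (h : LinearIndependent ℝ ![v, w])
    {r s : ℝ} (h0 : r • v + s • w = 0) : r = 0 ∧ s = 0 :=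
  LinearIndependent.pair_iff.mp h r s h0

/-- The loads of `f` all sit at points of `T`. -/
def LoadedOn (T : Set (EuclideanSpace ℝ (Fin d))) (f : Dof d →₀ ℝ) : Prop :=
  ∀ a, f a ≠ 0 → a.1 ∈ T

theorem LoadedOn.eq_zero {f : Dof d →₀ ℝ} (h : LoadedOn T f) {a : Dof d} (ha : a.1 ∉ T) :
    f a = 0 := by
  by_contra h0
  exact ha (h a h0)

theorem LoadedOn.add {f g : Dof d →₀ ℝ} (hf : LoadedOn T f) (hg : LoadedOn T g) :
    LoadedOn T (f + g) := fun a ha => by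
  by_contra h
  exact ha (by simp [hf.eq_zero h, hg.eq_zero h])

theorem LoadedOn.smul {f : Dof d →₀ ℝ} (hf : LoadedOn T f) (r : ℝ) : LoadedOn T (r • f) :=
  fun a ha => by
    by_contra h
    exact ha (by simp [hf.eq_zero h])

theorem loadedOn_load {p : EuclideanSpace ℝ (Fin d)} (hp : p ∈ T) (v : EuclideanSpace ℝ (Fin d)) :
    LoadedOn T (load p v) := fun a ha => by
  by_contra h
  exact ha (load_apply_of_ne (fun e : a.1 = p => h (e ▸ hp)) v a.2)

theorem loadedOn_bar {p q : EuclideanSpace ℝ (Fin d)} (hp : p ∈ T) (hq : q ∈ T) :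
    LoadedOn T (bar p q) := fun a ha => by
  rcases bar_apply_ne_zero ha with h | h <;> rwa [h]

theorem LoadedOn.mono {f : Dof d →₀ ℝ} (hf : LoadedOn T f) {T' : Set (EuclideanSpace ℝ (Fin d))}
    (h : T ⊆ T') : LoadedOn T' f := fun a ha => h (hf a ha)

theorem supported_transfer {p q v : EuclideanSpace ℝ (Fin d)} {c : ℝ} (hp : p ∈ T) (hq : q ∈ T)
    (hc : c ≠ 0) (h : p - q = c • v) : Supported U D T (load p v - load q v) := by
  have : load p v - load q v = c⁻¹ • bar p q := by
    rw [bar, h, load_smul, load_smul, ← smul_sub, smul_smul, inv_mul_cancel₀ hc, one_smul]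
  rw [this]
  exact (supported_bar hp hq).smul _

/-- Three forces along concurrent lines, carried by a small triangle around the common point. -/
theorem supported_three (hU : IsOpen U) (hT : T.Finite) {a b q F G : EuclideanSpace ℝ (Fin d)}
    (ha : a ∈ T) (hb : b ∈ T) (hq : q ∈ T) (hbU : b ∈ U) (hFG : LinearIndependent ℝ ![F, G])
    {r s : ℝ} (haF : a - b = r • F) (hqG : q - b = s • G) :
    Supported U D T (load a F + load q G - load b (F + G)) := by
  have hsupp : LoadedOn T (load a F + load q G - load b (F + G)) := by
    rw [sub_eq_add_neg, ← load_neg]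
    exact ((loadedOn_load ha _).add (loadedOn_load hq _)).add (loadedOn_load hb _)
  refine supported_of_sum hsupp fun S hS => ?_
  · have hF : F ≠ 0 := hFG.ne_zero 0
    have hG : G ≠ 0 := hFG.ne_zero 1
    have hH : -(F + G) ≠ 0 := fun h => by
      have := pair_comb hFG (r := 1) (s := 1) (by rw [one_smul, one_smul, ← neg_eq_zero, h])
      exact one_ne_zero this.1
    obtain ⟨τ, ⟨⟨⟨hAU, hAS⟩, hQU, hQS⟩, hBU, hBS⟩, hτ⟩ :=
      (((eventually_fresh hU hbU (hS.union hT) hF).and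
        (eventually_fresh hU hbU (hS.union hT) hG)).and
        (eventually_fresh hU hbU (hS.union hT) hH)).and self_mem_nhdsWithin |>.exists
    have hτ0 : τ ≠ 0 := ne_of_gt hτ
    obtain ⟨A, hA⟩ : ∃ A, A = b + τ • F := ⟨_, rfl⟩
    obtain ⟨Q, hQ⟩ : ∃ Q, Q = b + τ • G := ⟨_, rfl⟩
    obtain ⟨B, hB⟩ : ∃ B, B = b + τ • -(F + G) := ⟨_, rfl⟩
    rw [← hA] at hAU hAS
    rw [← hQ] at hQU hQS
    rw [← hB] at hBU hBS
    simp only [Set.mem_union, not_or] at hAS hQS hBS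
    have hAQ : A ≠ Q := fun h => by
      have h1 : τ • F + (-τ) • G = 0 := by
        rw [neg_smul, ← sub_eq_add_neg, sub_eq_zero]
        simpa [hA, hQ] using h
      exact hτ0 (pair_comb hFG h1).1
    have hAB : A ≠ B := fun h => by
      have h1 : (τ * 2) • F + τ • G = 0 := by
        have h2 : τ • F = τ • -(F + G) := by simpa [hA, hB] using h
        have h3 : (τ * 2) • F + τ • G = τ • F - τ • -(F + G) := by module
        rw [h3, h2, sub_self]
      exact hτ0 (pair_comb hFG h1).2
    have hQB : Q ≠ B := fun h => by
      have h1 : τ • F + (τ * 2) • G = 0 := by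
        have h2 : τ • G = τ • -(F + G) := by simpa [hQ, hB] using h
        have h3 : τ • F + (τ * 2) • G = τ • G - τ • -(F + G) := by module
        rw [h3, h2, sub_self]
      exact hτ0 (pair_comb hFG h1).1
    have hne : ∀ x ∈ T, A ≠ x ∧ Q ≠ x ∧ B ≠ x := fun x hx =>
      ⟨fun h => hAS.2 (h ▸ hx), fun h => hQS.2 (h ▸ hx), fun h => hBS.2 (h ▸ hx)⟩
    have hr : r - τ ≠ 0 := fun h => (hne a ha).1 (by
      rw [hA, ← sub_eq_zero.mp h, ← haF, add_sub_cancel])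
    have hs : s - τ ≠ 0 := fun h => (hne q hq).2.1 (by
      rw [hQ, ← sub_eq_zero.mp h, ← hqG, add_sub_cancel])
    -- The corners lie on the three lines of force through `b`, so each given force is carried to
    -- its corner by a bar. The sides have directions F - G, 2F + G and F + 2G, and the factor 1/3
    -- balances each corner, for instance -F + (F - G)/3 + (2F + G)/3 = 0 at `A`.
    refine ⟨{A, Q, B}, 6, ![load a F - load A F, load q G - load Q G,
      load b (-(F + G)) - load B (-(F + G)), (1 / 3 : ℝ) • (load A (F - G) - load Q (F - G)),
      (1 / 3 : ℝ) • (load A (F + F + G) - load B (F + F + G)),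
      (1 / 3 : ℝ) • (load Q (F + G + G) - load B (F + G + G))], by norm_num, by simp, ?_, ?_, ?_,
      ?_, ?_, ?_⟩
    · rintro x (rfl | rfl | rfl) <;> assumption
    · rw [Set.disjoint_right]
      rintro x (rfl | rfl | rfl)
      exacts [hAS.1, hQS.1, hBS.1]
    · rw [Set.disjoint_right]
      rintro x (rfl | rfl | rfl)
      exacts [hAS.2, hQS.2, hBS.2]
    · have hA' : A ∈ T ∪ {A, Q, B} := by simp
      have hQ' : Q ∈ T ∪ {A, Q, B} := by simp
      have hB' : B ∈ T ∪ {A, Q, B} := by simp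
      intro j
      fin_cases j
      · refine supported_transfer (Or.inl ha) hA' hr ?_
        rw [hA, sub_add_eq_sub_sub, haF, sub_smul]
      · refine supported_transfer (Or.inl hq) hQ' hs ?_
        rw [hQ, sub_add_eq_sub_sub, hqG, sub_smul]
      · refine supported_transfer (Or.inl hb) hB' (neg_ne_zero.mpr hτ0) ?_
        rw [hB]
        module
      · refine (supported_transfer hA' hQ' hτ0 ?_).smul _
        rw [hA, hQ]
        module
      · refine (supported_transfer hA' hB' hτ0 ?_).smul _
        rw [hA, hB]
        module
      · refine (supported_transfer hQ' hB' hτ0 ?_).smul _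
        rw [hQ, hB]
        module
    · simp only [Fin.sum_univ_six, Matrix.cons_val, load_add, load_sub, load_neg]
      module
    · intro τ' hτ'
      have eA := fun k => hτ' (A, k) (by simp)
      have eQ := fun k => hτ' (Q, k) (by simp)
      have eB := fun k => hτ' (B, k) (by simp)
      simp only [Fin.sum_univ_six, Matrix.cons_val, Finsupp.sub_apply, Finsupp.smul_apply,
        load_apply_same, load_apply_of_ne (hne a ha).1, load_apply_of_ne (hne q hq).1,
        load_apply_of_ne (hne b hb).1, load_apply_of_ne (hne a ha).2.1,
        load_apply_of_ne (hne q hq).2.1, load_apply_of_ne (hne b hb).2.1,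
        load_apply_of_ne (hne a ha).2.2, load_apply_of_ne (hne q hq).2.2,
        load_apply_of_ne (hne b hb).2.2, load_apply_of_ne hAQ, load_apply_of_ne hAB,
        load_apply_of_ne hQB, load_apply_of_ne hAQ.symm, load_apply_of_ne hAB.symm,
        load_apply_of_ne hQB.symm, PiLp.add_apply, PiLp.sub_apply, PiLp.neg_apply,
        smul_eq_mul] at eA eQ eB
      push_cast at eA eQ eB
      -- Comparing the coefficients of `F` and `G` at each corner determines all six tensions from
      -- that of the side `A`-`Q`.
      obtain ⟨hA1, hA2⟩ := eq_zero_of_pair (α := -τ' 0 + τ' 3 / 3 + τ' 4 * 2 / 3)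
        (β := -τ' 3 / 3 + τ' 4 / 3) hFG fun k => by linear_combination eA k
      obtain ⟨hQ1, hQ2⟩ := eq_zero_of_pair (α := -τ' 3 / 3 + τ' 5 / 3)
        (β := -τ' 1 + τ' 3 / 3 + τ' 5 * 2 / 3) hFG fun k => by linear_combination eQ k
      obtain ⟨hB1, hB2⟩ := eq_zero_of_pair (α := τ' 2 - τ' 4 * 2 / 3 - τ' 5 / 3)
        (β := τ' 2 - τ' 4 / 3 - τ' 5 * 2 / 3) hFG fun k => by linear_combination eB k
      have e4 : τ' 4 = τ' 3 := by linear_combination 3 * hA2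
      have e5 : τ' 5 = τ' 3 := by linear_combination 3 * hQ1
      have e0 : τ' 0 = τ' 3 := by linear_combination -hA1 + 2 / 3 * e4
      have e1 : τ' 1 = τ' 3 := by linear_combination -hQ2 + 2 / 3 * e5
      have e2 : τ' 2 = τ' 3 := by linear_combination hB1 + 2 / 3 * e4 + 1 / 3 * e5
      have : ∀ i, τ' i = τ' 3 := by
        intro i
        fin_cases i <;> first | exact e0 | exact e1 | exact e2 | exact e4 | exact e5 | rfl
      intro i j
      rw [this i, this j]

/-- Two bars with a common end, tied so that their tensions keep a fixed ratio. -/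
theorem supported_path (hU : IsOpen U) (hT : T.Finite) {a b q : EuclideanSpace ℝ (Fin d)}
    (ha : a ∈ T) (hb : b ∈ T) (hq : q ∈ T) (hbU : b ∈ U)
    (h : LinearIndependent ℝ ![a - b, q - b]) {t κ : ℝ} (ht : t ≠ 0) (hκ : κ ≠ 0) :
    Supported U D T (t • bar a b + κ • bar b q) := by
  have h1 := supported_three (D := D) hU hT ha hb hq hbU (pair_smul h ht hκ)
    (r := t⁻¹) (s := κ⁻¹) (by rw [smul_smul, inv_mul_cancel₀ ht, one_smul])
    (by rw [smul_smul, inv_mul_cancel₀ hκ, one_smul])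
  convert h1 using 1
  rw [bar_comm b q, bar, bar, load_add, load_smul, load_smul, load_smul, load_smul]
  module

theorem bar_split (p q : EuclideanSpace ℝ (Fin d)) {τ : ℝ} (h0 : τ ≠ 0) (h1 : 1 - τ ≠ 0) :
    bar p q = τ⁻¹ • bar p (p + τ • (q - p)) + (1 - τ)⁻¹ • bar (p + τ • (q - p)) q := by
  obtain ⟨m, hm⟩ : ∃ m, m = p + τ • (q - p) := ⟨_, rfl⟩
  have e1 : p - m = τ • (p - q) := by rw [hm]; module
  have e2 : m - q = (1 - τ) • (p - q) := by rw [hm]; module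
  rw [← hm, bar, bar, bar, e1, e2]
  simp only [load_smul, ← smul_sub, smul_smul, inv_mul_cancel₀ h0, inv_mul_cancel₀ h1, one_smul]
  abel

theorem exists_bar_apply_ne_zero {p q : EuclideanSpace ℝ (Fin d)} (h : p ≠ q) :
    ∃ k, bar p q (q, k) ≠ 0 := by
  by_contra! hc
  refine h ?_
  ext k
  have := hc k
  rw [bar_apply_right h] at this
  linarith

/-- `f` stays supported after a bar with one end at `p` is tied to it, in any direction but
that of `v`. -/
structure Linkable (U : Set (EuclideanSpace ℝ (Fin d))) (D : Set (ℂ × ℂ))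
    (T : Set (EuclideanSpace ℝ (Fin d))) (f : Dof d →₀ ℝ) (p v : EuclideanSpace ℝ (Fin d)) :
    Prop where
  mem : p ∈ T
  mem_open : p ∈ U
  loadedOn : LoadedOn T f
  supported : ∀ q ∈ U, LinearIndependent ℝ ![v, q - p] → ∀ κ : ℝ, κ ≠ 0 →
    Supported U D (insert q T) (f + κ • bar p q)

theorem Linkable.mono {f : Dof d →₀ ℝ} {p v : EuclideanSpace ℝ (Fin d)}
    (h : Linkable U D T f p v) {T' : Set (EuclideanSpace ℝ (Fin d))} (hT : T ⊆ T')
    (hT' : T'.Finite) : Linkable U D T' f p v :=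
  ⟨hT h.mem, h.mem_open, h.loadedOn.mono hT, fun q hq hv κ hκ =>
    (h.supported q hq hv κ hκ).mono (Set.insert_subset_insert hT) (hT'.insert q)⟩

/-- Starting point of the chains: a single bar, to which `supported_path` ties the next one. -/
theorem linkable_bar (hU : IsOpen U) (hT : T.Finite) {a b : EuclideanSpace ℝ (Fin d)}
    (ha : a ∈ T) (hb : b ∈ T) (hbU : b ∈ U) {t : ℝ} (ht : t ≠ 0) :
    Linkable U D T (t • bar a b) b (b - a) := by
  refine ⟨hb, hbU, (loadedOn_bar ha hb).smul t, fun q hq hv κ hκ => ?_⟩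
  refine supported_path hU (hT.insert q) (by simp [ha]) (by simp [hb]) (by simp) hbU ?_ ht hκ
  have := pair_smul hv (r := -1) (s := 1) (by norm_num) one_ne_zero
  simpa using this

/-- The bar `p`-`q` is cut at a fresh interior point `m`. Its first half is tied to `f` by
hypothesis, its second half is tied to the next bar by `supported_path`, and the two parts are
joined by cancellation at `m`. -/
theorem Linkable.extend {f : Dof d →₀ ℝ} {p q v : EuclideanSpace ℝ (Fin d)}
    (h : Linkable U D T f p v) (hU : IsOpen U) (hT : T.Finite) (hq : q ∈ T) (hqU : q ∈ U)
    (hv : LinearIndependent ℝ ![v, q - p]) {t : ℝ} (ht : t ≠ 0) :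
    Linkable U D T (f + t • bar p q) q (q - p) := by
  refine ⟨hq, hqU, h.loadedOn.add ((loadedOn_bar h.mem hq).smul t),
    fun q' hq'U hv' κ hκ => ?_⟩
  have hqp : q - p ≠ 0 := hv.ne_zero 1
  have hT1 : (insert q' T).Finite := hT.insert q'
  have hsub : T ⊆ insert q' T := Set.subset_insert _ _
  refine supported_add_of_cancel ((((h.loadedOn.mono hsub).add
    ((loadedOn_bar (hsub h.mem) (hsub hq)).smul t))).add
    ((loadedOn_bar (hsub hq) (Set.mem_insert _ _)).smul κ)) fun S hS => ?_
  obtain ⟨τ, ⟨hmU, hmS⟩, hτ, hτ1⟩ :=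
    ((eventually_fresh hU h.mem_open (hS.union hT1) hqp).and
      (Ioo_mem_nhdsGT (zero_lt_one' ℝ))).exists
  have hτ0 : τ ≠ 0 := ne_of_gt hτ
  have hτ1' : 1 - τ ≠ 0 := (sub_pos.mpr hτ1).ne'
  have hsplit := bar_split p q hτ0 hτ1'
  obtain ⟨m, hm⟩ : ∃ m, m = p + τ • (q - p) := ⟨_, rfl⟩
  rw [← hm] at hmU hmS hsplit
  simp only [Set.mem_union, not_or] at hmS
  have hmp : m - p = τ • (q - p) := by rw [hm]; module
  have hpm : p ≠ m := fun e => hmS.2 (e ▸ hsub h.mem)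
  refine ⟨m, f + (t * τ⁻¹) • bar p m, hmU, hmS.1, hmS.2, ?_, ?_, ?_⟩
  · obtain ⟨k, hk⟩ := exists_bar_apply_ne_zero hpm
    refine ⟨k, ?_⟩
    rw [Finsupp.add_apply, h.loadedOn.eq_zero (a := (m, k)) fun e => hmS.2 (hsub e), zero_add,
      Finsupp.smul_apply, smul_eq_mul]
    exact mul_ne_zero (mul_ne_zero ht (inv_ne_zero hτ0)) hk
  · refine (h.supported m hmU ?_ _ (mul_ne_zero ht (inv_ne_zero hτ0))).mono
      (Set.insert_subset_insert hsub) (hT1.insert m)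
    rw [hmp]
    simpa using pair_smul hv one_ne_zero hτ0
  · have e : f + t • bar p q + κ • bar q q' - (f + (t * τ⁻¹) • bar p m) =
        (t * (1 - τ)⁻¹) • bar m q + κ • bar q q' := by
      rw [hsplit]
      module
    rw [e]
    refine supported_path hU (hT1.insert m) (by simp) (by simp [hq]) (by simp) hqU ?_
      (mul_ne_zero ht (inv_ne_zero hτ1')) hκ
    have hmq : m - q = (-(1 - τ)) • (q - p) := by rw [hm]; module
    rw [hmq]
    simpa using pair_smul hv' (neg_ne_zero.mpr hτ1') one_ne_zero

theorem pair_of_line {p v w : EuclideanSpace ℝ (Fin d)} (hv : v ≠ 0)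
    (h : ∀ r : ℝ, w ≠ p + r • v) : LinearIndependent ℝ ![v, w - p] := by
  rw [LinearIndependent.pair_iff' hv]
  intro r hr
  exact h r (by rw [hr]; abel)

/-- The bar `a`-`b` may be out of reach of `p`, so the chain takes the detour `p`, `w`, `a`, `b`
through a generic point `w`. The auxiliary bars `p`-`w` and `w`-`a` are then removed by a path with
the opposite forces, which cancels at `w`. -/
theorem Linkable.add_bar (hd : 2 ≤ d) {f : Dof d →₀ ℝ} {p v : EuclideanSpace ℝ (Fin d)}
    (h : Linkable U D T f p v) (hv : v ≠ 0) (hU : IsOpen U) (hT : T.Finite) (hTU : T ⊆ U)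
    {a b : EuclideanSpace ℝ (Fin d)} (ha : a ∈ T) (hb : b ∈ T) (hab : a ≠ b) (hap : a ≠ p)
    {t : ℝ} (ht : t ≠ 0) : Linkable U D T (f + t • bar a b) b (b - a) := by
  refine ⟨hb, hTU hb, h.loadedOn.add ((loadedOn_bar ha hb).smul t), fun y hyU hv' κ hκ => ?_⟩
  have hT1 : (insert y T).Finite := hT.insert y
  have hsub : T ⊆ insert y T := Set.subset_insert _ _
  refine supported_add_of_cancel ((((h.loadedOn.mono hsub).add
    ((loadedOn_bar (hsub ha) (hsub hb)).smul t))).add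
    ((loadedOn_bar (hsub hb) (Set.mem_insert _ _)).smul κ)) fun S hS => ?_
  -- Avoiding these three lines makes consecutive members of the detour non-parallel at `p`, `w` and
  -- `a`.
  obtain ⟨w, hwU, hwS, hw⟩ := exists_generic hd hU ⟨p, h.mem_open⟩ (hS.union hT1)
    ![(p, v), (a, p - a), (a, b - a)]
  simp only [Set.mem_union, not_or] at hwS
  have i1 : LinearIndependent ℝ ![v, w - p] := pair_of_line hv (hw 0)
  have i2 : LinearIndependent ℝ ![p - a, w - a] := pair_of_line (sub_ne_zero.mpr hap.symm) (hw 1)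
  have i3 : LinearIndependent ℝ ![b - a, w - a] := pair_of_line (sub_ne_zero.mpr hab.symm) (hw 2)
  have i2' : LinearIndependent ℝ ![w - p, a - w] := by
    rw [LinearIndependent.pair_iff] at i2 ⊢
    intro r s hrs
    have := i2 (-r) (r - s) (by rw [← hrs]; module)
    constructor <;> linarith [this.1, this.2]
  have i3' : LinearIndependent ℝ ![a - w, b - a] := by
    rw [LinearIndependent.pair_iff] at i3 ⊢
    intro r s hrs
    have := i3 s (-r) (by rw [← hrs]; module)
    constructor <;> linarith [this.1, this.2]
  have hT2 : (insert w (insert y T)).Finite := hT1.insert w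
  have hsub2 : T ⊆ insert w (insert y T) := hsub.trans (Set.subset_insert _ _)
  have hwT : w ∉ T := fun e => hwS.2 (hsub e)
  have hwp : p ≠ w := fun e => hwT (e ▸ h.mem)
  have hwa : a ≠ w := fun e => hwT (e ▸ ha)
  have hwb : b ≠ w := fun e => hwT (e ▸ hb)
  have hwy : w ≠ y := fun e => hwS.2 (e ▸ Set.mem_insert _ _)
  have c1 := (h.mono hsub2 hT2).extend hU hT2 (Set.mem_insert w _) hwU i1 one_ne_zero
  have c2 := c1.extend hU hT2 (hsub2 ha) (hTU ha) i2' one_ne_zero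
  have c3 := c2.extend hU hT2 (hsub2 hb) (hTU hb) i3' ht
  have c4 := c3.supported y hyU hv' κ hκ
  rw [Set.insert_eq_of_mem (by simp)] at c4
  refine ⟨w, _, hwU, hwS.1, hwS.2, ?_, c4, ?_⟩
  -- The load of the chain at `w` is the negative of this vector, nonzero because p - w and a - w
  -- are independent.
  · have : ∃ k, (p - w + (a - w)) k ≠ 0 := by
      by_contra! hcon
      have h0 : (-1 : ℝ) • (w - p) + (1 : ℝ) • (a - w) = 0 := by
        ext k
        have := hcon k
        simp at this ⊢
        linarith
      exact one_ne_zero (pair_comb i2' h0).2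
    obtain ⟨k, hk⟩ := this
    refine ⟨k, ?_⟩
    simp only [Finsupp.add_apply, Finsupp.smul_apply, smul_eq_mul, one_mul,
      h.loadedOn.eq_zero (a := (w, k)) hwT, bar_apply_right hwp, bar_apply_left hwa.symm,
      bar_apply_of_ne hwa.symm hwb.symm, bar_apply_of_ne hwb.symm hwy]
    simp at hk
    intro h0
    apply hk
    linarith
  · have e : f + t • bar a b + κ • bar b y -
        (f + (1 : ℝ) • bar p w + (1 : ℝ) • bar w a + t • bar a b + κ • bar b y) =
        (-1 : ℝ) • bar p w + (-1 : ℝ) • bar w a := by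
      module
    rw [e]
    refine supported_path hU hT2 (hsub2 h.mem) (by simp) (hsub2 ha) hwU ?_ (by norm_num)
      (by norm_num)
    simpa using pair_smul i2' (r := -1) (s := 1) (by norm_num) one_ne_zero

/-- A bar to a generic fresh node `w` is tied to `f` and then cancelled at `w` by a bar with the
opposite coefficient. -/
theorem Linkable.toSupported (hd : 2 ≤ d) {f : Dof d →₀ ℝ} {p v : EuclideanSpace ℝ (Fin d)}
    (h : Linkable U D T f p v) (hv : v ≠ 0) (hU : IsOpen U) (hT : T.Finite) :
    Supported U D T f := by
  refine supported_add_of_cancel h.loadedOn fun S hS => ?_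
  obtain ⟨w, hwU, hwS, hw⟩ := exists_generic hd hU ⟨p, h.mem_open⟩ (hS.union hT)
    fun _ => (p, v)
  simp only [Set.mem_union, not_or] at hwS
  have hpw : p ≠ w := fun e => hwS.2 (e ▸ h.mem)
  refine ⟨w, f + (1 : ℝ) • bar p w, hwU, hwS.1, hwS.2, ?_,
    h.supported w hwU (pair_of_line hv (hw 0)) 1 one_ne_zero, ?_⟩
  · obtain ⟨k, hk⟩ := exists_bar_apply_ne_zero hpw
    refine ⟨k, ?_⟩
    simpa [h.loadedOn.eq_zero (a := (w, k)) hwS.2] using hk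
  · have e : f - (f + (1 : ℝ) • bar p w) = (-1 : ℝ) • bar p w := by module
    rw [e]
    exact (supported_bar (by simp [h.mem]) (by simp)).smul _

/-- Every combination of bars between points of `T` is supported. -/
theorem supported_of_mem_span (hd : 2 ≤ d) (hU : IsOpen U) (hT : T.Finite) (hTU : T ⊆ U)
    {f : Dof d →₀ ℝ}
    (hf : f ∈ Submodule.span ℝ {g | ∃ p ∈ T, ∃ q ∈ T, g = bar p q}) : Supported U D T f := by
  -- Quantifying over the scale `r` and the chain `g` lets the span induction append bars one at a
  -- time.
  have key : ∀ h ∈ Submodule.span ℝ {g | ∃ p ∈ T, ∃ q ∈ T, g = bar p q}, ∀ (r : ℝ) (g : Dof d →₀ ℝ),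
      (∃ p v, v ≠ 0 ∧ Linkable U D T g p v) → ∃ p v, v ≠ 0 ∧ Linkable U D T (g + r • h) p v := by
    intro h hh
    induction hh using Submodule.span_induction with
    | mem x hx =>
      obtain ⟨a, ha, b, hb, rfl⟩ := hx
      rintro r g ⟨p, v, hv, hg⟩
      rcases eq_or_ne r 0 with rfl | hr
      · exact ⟨p, v, hv, by simpa using hg⟩
      rcases eq_or_ne a b with rfl | hab
      · exact ⟨p, v, hv, by simpa [bar, load_zero] using hg⟩
      -- `add_bar` must enter the new bar at an end other than `p`; since a ≠ b, one of the two
      -- orientations qualifies.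
      rcases eq_or_ne a p with rfl | hap
      · refine ⟨a, a - b, sub_ne_zero.mpr hab, ?_⟩
        rw [bar_comm]
        exact hg.add_bar hd hv hU hT hTU hb ha hab.symm hab.symm hr
      · exact ⟨b, b - a, sub_ne_zero.mpr hab.symm, hg.add_bar hd hv hU hT hTU ha hb hab hap hr⟩
    | zero =>
      intro r g hg
      simpa using hg
    | add x y _ _ hx hy =>
      intro r g hg
      rw [smul_add, ← add_assoc]
      exact hy r _ (hx r g hg)
    | smul c x _ hx =>
      intro r g hg
      rw [smul_smul]
      exact hx _ g hg
  by_cases h0 : ∃ a ∈ T, ∃ b ∈ T, a ≠ b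
  · obtain ⟨a, ha, b, hb, hab⟩ := h0
    have h1 := linkable_bar (D := D) hU hT ha hb (hTU hb) one_ne_zero
    -- The chain needs a first bar, so one bar is placed at the start and subtracted from what is
    -- appended.
    obtain ⟨p, v, hv, h2⟩ := key (f - (1 : ℝ) • bar a b)
      (Submodule.sub_mem _ hf (Submodule.smul_mem _ _ (Submodule.subset_span ⟨a, ha, b, hb, rfl⟩)))
      1 _ ⟨b, b - a, sub_ne_zero.mpr hab.symm, h1⟩
    rw [one_smul, one_smul, add_sub_cancel] at h2
    exact h2.toSupported hd hv hU hT
  · push Not at h0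
    have : f = 0 := by
      rw [← Submodule.mem_bot ℝ]
      refine (Submodule.span_le.mpr ?_) hf
      rintro _ ⟨a, ha, b, hb, rfl⟩
      simp [h0 a ha b hb, bar, load_zero]
    rw [this, Supported]
    have e : (fun z : ℂ × ℂ => z.1 • rankOne (0 : Dof d →₀ ℝ)) = 0 := by
      funext z u a
      simp [rankOne]
    rw [e]
    exact synthesizable_zero

end Dof

/-! ### Balanced systems of forces, and resonant responses. -/

namespace Dof

variable {d : ℕ} {U : Set (EuclideanSpace ℝ (Fin d))} {D : Set (ℂ × ℂ)}
  {T : Set (EuclideanSpace ℝ (Fin d))}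

/-- The system of forces `f` does no work on infinitesimal rigid motions. -/
def Balanced (f : Dof d →₀ ℝ) : Prop :=
  ∀ (c : Fin d → ℝ) (B : Matrix (Fin d) (Fin d) ℝ), (∀ i j, B i j = -B j i) →
    Finsupp.linearCombination ℝ (fun a : Dof d => c a.2 + ∑ t, B a.2 t * a.1 t) f = 0

theorem linearCombination_congr {f : Dof d →₀ ℝ} {u v : Dof d → ℝ}
    (h : ∀ a, f a ≠ 0 → u a = v a) :
    Finsupp.linearCombination ℝ u f = Finsupp.linearCombination ℝ v f := by
  rw [Finsupp.linearCombination_apply, Finsupp.linearCombination_apply]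
  refine Finsupp.sum_congr fun a ha => ?_
  rw [h a (Finsupp.mem_support_iff.mp ha)]

/-- An infinitesimal motion that preserves all distances between points of `T` is rigid on `T`,
if `T` contains an orthogonal frame. -/
theorem exists_rigid {T : Set (EuclideanSpace ℝ (Fin d))} {u : Dof d → ℝ}
    (hu : ∀ p ∈ T, ∀ q ∈ T, ∑ k, (p k - q k) * (u (p, k) - u (q, k)) = 0)
    {p₀ : EuclideanSpace ℝ (Fin d)} {τ : ℝ} (hτ : τ ≠ 0) (hp₀ : p₀ ∈ T)
    (hframe : ∀ k, p₀ + τ • EuclideanSpace.single k (1 : ℝ) ∈ T) :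
    ∃ (c : Fin d → ℝ) (B : Matrix (Fin d) (Fin d) ℝ), (∀ i j, B i j = -B j i) ∧
      ∀ a : Dof d, a.1 ∈ T → u a = c a.2 + ∑ t, B a.2 t * a.1 t := by
  obtain ⟨b, hb⟩ : ∃ b : Fin d → EuclideanSpace ℝ (Fin d),
    b = fun k => p₀ + τ • EuclideanSpace.single k (1 : ℝ) := ⟨_, rfl⟩
  have hbT : ∀ j, b j ∈ T := fun j => by simpa [hb] using hframe j
  have hbk : ∀ j k, b j k - p₀ k = if k = j then τ else 0 := fun j k => by
    simp [hb]
  -- Polarization: preserving distances to first order makes (p - p₀)·(u(q) - u(p₀)) antisymmetric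
  -- in `p` and `q`.
  have hpol : ∀ p ∈ T, ∀ q ∈ T, ∑ k, (p k - p₀ k) * (u (q, k) - u (p₀, k)) +
      ∑ k, (q k - p₀ k) * (u (p, k) - u (p₀, k)) = 0 := fun p hp q hq => by
    have h1 := hu p hp p₀ hp₀
    have h2 := hu q hq p₀ hp₀
    have h3 := hu p hp q hq
    have h4 : ∑ k, (p k - p₀ k) * (u (q, k) - u (p₀, k)) +
        ∑ k, (q k - p₀ k) * (u (p, k) - u (p₀, k)) =
        ∑ k, (p k - p₀ k) * (u (p, k) - u (p₀, k)) + ∑ k, (q k - p₀ k) * (u (q, k) - u (p₀, k)) -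
        ∑ k, (p k - q k) * (u (p, k) - u (q, k)) := by
      simp only [← Finset.sum_add_distrib, ← Finset.sum_sub_distrib]
      exact Finset.sum_congr rfl fun k _ => by ring
    rw [h4, h1, h2, h3]
    norm_num
  -- Taking `p` to be the frame point `b j` expresses `u (q, j)` as an affine function of `q`.
  have hlin : ∀ q ∈ T, ∀ j, u (q, j) - u (p₀, j) =
      -τ⁻¹ * ∑ k, (q k - p₀ k) * (u (b j, k) - u (p₀, k)) := fun q hq j => by
    have h := hpol (b j) (hbT j) q hq
    simp only [hbk, ite_mul, zero_mul, Finset.sum_ite_eq', Finset.mem_univ, if_true] at h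
    field_simp
    linarith
  refine ⟨fun j => u (p₀, j) - ∑ k, (-τ⁻¹ * (u (b j, k) - u (p₀, k))) * p₀ k,
    fun j k => -τ⁻¹ * (u (b j, k) - u (p₀, k)), fun i j => ?_, fun a ha => ?_⟩
  · have h := hpol (b i) (hbT i) (b j) (hbT j)
    simp only [hbk, ite_mul, zero_mul, Finset.sum_ite_eq', Finset.mem_univ, if_true] at h
    field_simp
    have h' : τ * (u (b j, i) - u (p₀, i) + (u (b i, j) - u (p₀, j))) = 0 := by linarith
    have := (mul_eq_zero.mp h').resolve_left hτ
    linarith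
  · have h := hlin a.1 ha a.2
    have h5 : u a = u (p₀, a.2) + -τ⁻¹ * ∑ k, (a.1 k - p₀ k) * (u (b a.2, k) - u (p₀, k)) := by
      rw [← h]
      ring
    rw [h5, sub_add_eq_add_sub, add_sub_assoc, ← Finset.sum_sub_distrib, Finset.mul_sum]
    congr 1
    exact Finset.sum_congr rfl fun k _ => by ring

/-- Otherwise some functional kills all bars but not `f`. Read as a displacement field it preserves
distances to first order, so `exists_rigid` makes it a rigid motion on `T`, on which a balanced `f`
does no work. -/
theorem mem_span_bar_of_balanced {f : Dof d →₀ ℝ} (hfT : LoadedOn T f) (hf : Balanced f)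
    {p₀ : EuclideanSpace ℝ (Fin d)} {τ : ℝ} (hτ : τ ≠ 0) (hp₀ : p₀ ∈ T)
    (hframe : ∀ k, p₀ + τ • EuclideanSpace.single k (1 : ℝ) ∈ T) :
    f ∈ Submodule.span ℝ {g | ∃ p ∈ T, ∃ q ∈ T, g = bar p q} := by
  by_contra hcon
  obtain ⟨φ, hφ, hker⟩ := Submodule.exists_le_ker_of_notMem hcon
  obtain ⟨u, hu⟩ : ∃ u : Dof d → ℝ, u = fun a => φ (Finsupp.single a 1) := ⟨_, rfl⟩
  have hφu : φ = Finsupp.linearCombination ℝ u := by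
    refine Finsupp.lhom_ext fun a r => ?_
    rw [Finsupp.linearCombination_single, hu, ← map_smul, Finsupp.smul_single, smul_eq_mul, mul_one]
  have hbar : ∀ p ∈ T, ∀ q ∈ T, ∑ k, (p k - q k) * (u (p, k) - u (q, k)) = 0 :=
    fun p hp q hq => by
      have h : φ (bar p q) = 0 := hker (Submodule.subset_span ⟨p, hp, q, hq, rfl⟩)
      rw [← h, hφu, bar, load, load]
      simp only [map_sub, map_sum, Finsupp.linearCombination_single]
      rw [← Finset.sum_sub_distrib]
      refine Finset.sum_congr rfl fun k _ => ?_
      simp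
      ring
  obtain ⟨c, B, hB, hrig⟩ := exists_rigid hbar hτ hp₀ hframe
  apply hφ
  rw [hφu, linearCombination_congr fun a ha => hrig a (hfT a ha)]
  exact hf c B hB

/-- Every balanced system of forces spans the response of some network. -/
theorem supported_of_balanced (hd : 2 ≤ d) (hU : IsOpen U) (hT : T.Finite) (hTU : T ⊆ U)
    {f : Dof d →₀ ℝ} (hfT : LoadedOn T f) (hf : Balanced f) : Supported U D T f := by
  rcases T.eq_empty_or_nonempty with rfl | ⟨p₀, hp₀⟩
  · refine supported_of_mem_span hd hU hT hTU ?_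
    have : f = 0 := by
      ext a
      exact hfT.eq_zero (Set.notMem_empty _)
    rw [this]
    exact Submodule.zero_mem _
  · refine supported_of_unloaded hfT fun S hS => ?_
    -- The terminals may be degenerately placed, so fresh unloaded nodes supply the orthogonal
    -- frame.
    have hev : ∀ k : Fin d, ∀ᶠ τ : ℝ in nhdsWithin 0 (Set.Ioi 0),
        p₀ + τ • EuclideanSpace.single k (1 : ℝ) ∈ U ∧
        p₀ + τ • EuclideanSpace.single k (1 : ℝ) ∉ S ∪ T := fun k =>
      eventually_fresh hU (hTU hp₀) (hS.union hT) (by simp)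
    obtain ⟨τ, h, hτ⟩ := ((Filter.eventually_all.mpr hev).and self_mem_nhdsWithin).exists
    have hfin := Set.finite_range fun k : Fin d => p₀ + τ • EuclideanSpace.single k (1 : ℝ)
    refine ⟨_, hfin, ?_, ?_, ?_, ?_⟩
    · rintro _ ⟨k, rfl⟩
      exact (h k).1
    · rw [Set.disjoint_right]
      rintro _ ⟨k, rfl⟩ hk
      exact (h k).2 (Or.inl hk)
    · rw [Set.disjoint_right]
      rintro _ ⟨k, rfl⟩ hk
      exact (h k).2 (Or.inr hk)
    · refine supported_of_mem_span hd hU (hT.union hfin) (Set.union_subset hTU ?_) ?_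
      · rintro _ ⟨k, rfl⟩
        exact (h k).1
      · exact mem_span_bar_of_balanced (hfT.mono Set.subset_union_left) hf (ne_of_gt hτ)
          (Or.inl hp₀) fun k => Or.inr ⟨k, rfl⟩

/-! ### Resonances -/

/-- A rank-one response with equal masses at the fresh nodes that carry the loads `g`. -/
theorem condenses_resonance {r g : Dof d →₀ ℝ} {J : Set (EuclideanSpace ℝ (Fin d))}
    [DecidablePred (· ∈ J)] (hr : LoadedOn T r) (hg : LoadedOn J g) (hTJ : Disjoint T J)
    (hg0 : g ≠ 0) {σ : ℝ}
    (hσ : σ ≠ 0) {s w : ℂ} (hq : s * σ + w ≠ 0) :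
    Condenses (fun u a => (((σ⁻¹ : ℝ) : ℂ) * (s * rankOne (r + g) u a)) +
        w * (((if a.1 ∈ J then (∑ b ∈ g.support, g b ^ 2) / σ ^ 2 else 0 : ℝ) : ℂ) * u a)) J
      ((s * w / (σ * (s * σ + w))) • rankOne r) := by
  obtain ⟨G, hG⟩ : ∃ G, G = ∑ b ∈ g.support, g b ^ 2 := ⟨_, rfl⟩
  have hG0 : (G : ℂ) ≠ 0 := by
    obtain ⟨a, ha⟩ := Finsupp.ne_iff.mp hg0
    have : 0 < G := by
      rw [hG]
      exact Finset.sum_pos (fun b hb => by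
        have := Finsupp.mem_support_iff.mp hb
        positivity) ⟨a, Finsupp.mem_support_iff.mpr ha⟩
    exact_mod_cast this.ne'
  have hGc : (G : ℂ) = ∑ b ∈ g.support, (g b : ℂ) * g b := by
    rw [hG]
    push_cast
    exact Finset.sum_congr rfl fun b _ => sq _
  have hσ' : (σ : ℂ) ≠ 0 := by exact_mod_cast hσ
  rw [← hG]
  obtain ⟨q, rfl⟩ : ∃ q, w = q - s * σ := ⟨s * σ + w, by ring⟩
  rw [add_sub_cancel] at hq ⊢
  have hrJ : ∀ a : Dof d, a.1 ∈ J → r a = 0 := fun a ha =>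
    hr.eq_zero (Set.disjoint_right.mp hTJ ha)
  have hgJ : ∀ a : Dof d, a.1 ∉ J → g a = 0 := fun a ha => hg.eq_zero ha
  refine ⟨fun u₀ => ?_, fun u hu => ?_⟩
  -- With G = ∑ g² and u = c g on `J`, equilibrium reads (s/σ)(r·u₀ + cG) + w(G/σ²)c = 0; this `c`
  -- solves it.
  · obtain ⟨c, hc⟩ : ∃ c : ℂ, c = -(s * σ * work r u₀ / (q * G)) := ⟨_, rfl⟩
    refine ⟨fun a => if a.1 ∈ J then c * g a else u₀ a, fun a ha => by simp [ha], ?_⟩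
    have h1 : work r (fun a => if a.1 ∈ J then c * (g a : ℂ) else u₀ a) = work r u₀ := by
      refine work_congr fun a ha => ?_
      rw [if_neg fun h => ha (hrJ a h)]
    have h2 : work g (fun a => if a.1 ∈ J then c * (g a : ℂ) else u₀ a) = c * G := by
      rw [work_eq_sum, hGc, Finset.mul_sum]
      refine Finset.sum_congr rfl fun a ha => ?_
      rw [if_pos (hg a (Finsupp.mem_support_iff.mp ha))]
      ring
    funext a
    simp only [rankOne, work_add, h1, h2, Pi.smul_apply, smul_eq_mul, Finsupp.add_apply]
    by_cases ha : a.1 ∈ J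
    · simp only [ha, if_true, hrJ a ha, hc]
      push_cast
      field_simp
      ring
    · simp only [ha, if_false, hgJ a ha, hc]
      push_cast
      field_simp
      ring
  · obtain ⟨e, he⟩ : ∃ e, e = work r u + work g u := ⟨_, rfl⟩
    have hJ : ∀ a : Dof d, a.1 ∈ J →
        (σ : ℂ)⁻¹ * (s * (e * g a)) + (q - s * σ) * (G / σ ^ 2 * u a) = 0 :=
      fun a ha => by
        have := hu a ha
        simp only [rankOne, work_add, ← he, Finsupp.add_apply, hrJ a ha, ha, if_true] at this
        push_cast at this
        rwa [zero_add] at this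
    -- Pairing with `g` determines the elongation `e` even when w = 0, where the motion of the
    -- massive nodes is not unique.
    have hsum : (σ : ℂ)⁻¹ * s * e * G + (q - s * σ) * (G / σ ^ 2) * work g u = 0 := by
      have h0 : ∑ a ∈ g.support, (g a : ℂ) *
          ((σ : ℂ)⁻¹ * (s * (e * g a)) + (q - s * σ) * (G / σ ^ 2 * u a)) = 0 :=
        Finset.sum_eq_zero fun a ha => by
          rw [hJ a (hg a (Finsupp.mem_support_iff.mp ha)), mul_zero]
      rw [← h0, Finset.sum_congr rfl fun a _ => show (g a : ℂ) *
          ((σ : ℂ)⁻¹ * (s * (e * g a)) + (q - s * σ) * (G / σ ^ 2 * u a)) =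
          (σ : ℂ)⁻¹ * s * e * (g a * g a) + (q - s * σ) * (G / σ ^ 2) * (g a * u a) by ring,
        Finset.sum_add_distrib, ← Finset.mul_sum, ← Finset.mul_sum, ← hGc, ← work_eq_sum]
    have hg' : work g u = e - work r u := by rw [he]; ring
    have he' : e = (q - s * σ) * work r u / q := by
      rw [hg'] at hsum
      have h1 : (G : ℂ) * (q * e - (q - s * σ) * work r u) = 0 := by
        field_simp at hsum
        linear_combination hsum
      rw [eq_div_iff hq]
      linear_combination (mul_eq_zero.mp h1).resolve_left hG0
    funext a
    by_cases ha : a.1 ∈ J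
    · rw [hu a ha]
      simp [rankOne, hrJ a ha]
    · simp only [rankOne, work_add, ← he, Finsupp.add_apply, hgJ a ha, ha, if_false,
        Pi.smul_apply, smul_eq_mul, he']
      push_cast
      field_simp
      ring

theorem eq_sum_load [DecidableEq (EuclideanSpace ℝ (Fin d))] {r : Dof d →₀ ℝ}
    (X : Finset (EuclideanSpace ℝ (Fin d))) (hX : ∀ a, r a ≠ 0 → a.1 ∈ X) :
    r = ∑ x ∈ X, load x (WithLp.toLp 2 fun k => r (x, k)) := by
  ext ⟨x, k⟩
  rw [Finsupp.finsetSum_apply]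
  by_cases hx : x ∈ X
  · rw [Finset.sum_eq_single_of_mem x hx fun y _ hy => load_apply_of_ne hy.symm _ _,
      load_apply_same]
  · have : r (x, k) = 0 := by
      by_contra h
      exact hx (hX _ h)
    rw [this]
    refine (Finset.sum_eq_zero fun y hy => load_apply_of_ne (fun h : x = y => hx (h ▸ hy)) _ _).symm

/-- Each loaded point `x` is joined by a bar to a fresh massive node displaced along its own load,
and the opposite load is put there. Thus `r + g` is a combination of bars for arbitrary `r`. -/
theorem synthesizable_resonance (hd : 2 ≤ d) (hU : IsOpen U) (hT : T.Finite) (hTU : T ⊆ U)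
    {r : Dof d →₀ ℝ} (hr : LoadedOn T r) {σ : ℝ} (hσ : 0 < σ)
    (hD : ∀ z ∈ D, z.1 * σ + z.2 ≠ 0) :
    Synthesizable U D T fun z => (z.1 * z.2 / (σ * (z.1 * σ + z.2))) • rankOne r := by
  classical
  rcases eq_or_ne r 0 with rfl | hr0
  · have e : (fun z : ℂ × ℂ => (z.1 * z.2 / (σ * (z.1 * σ + z.2))) • rankOne (0 : Dof d →₀ ℝ)) =
        0 := by
      funext z u a
      simp [rankOne]
    rw [e]
    exact synthesizable_zero
  refine synthesizable_of_condenses (fun z => (localOn_rankOne hr).smul _) fun S hS => ?_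
  obtain ⟨⟨x₀, k₀⟩, hx₀⟩ := Finsupp.ne_iff.mp hr0
  obtain ⟨v, hv⟩ : ∃ v : EuclideanSpace ℝ (Fin d) → EuclideanSpace ℝ (Fin d),
    v = fun x => WithLp.toLp 2 fun k => r (x, k) := ⟨_, rfl⟩
  have hvk : ∀ x k, v x k = r (x, k) := fun x k => by simp [hv]
  obtain ⟨X, hX⟩ : ∃ X, X = r.support.image Prod.fst := ⟨_, rfl⟩
  have hXr : ∀ a, r a ≠ 0 → a.1 ∈ X := fun a ha => by
    rw [hX]
    exact Finset.mem_image_of_mem _ (Finsupp.mem_support_iff.mpr ha)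
  have hXv : ∀ x ∈ X, x ∈ T ∧ v x ≠ 0 := fun x hx => by
    rw [hX] at hx
    obtain ⟨a, ha, rfl⟩ := Finset.mem_image.mp hx
    have ha' := Finsupp.mem_support_iff.mp ha
    refine ⟨hr a ha', fun h => ha' ?_⟩
    rw [← hvk, h]
    rfl
  have hx₀X : x₀ ∈ X := hXr (x₀, k₀) hx₀
  have hsum : r = ∑ x ∈ X, load x (v x) := by
    rw [hv]
    exact eq_sum_load X hXr
  have hev1 : ∀ᶠ τ : ℝ in nhdsWithin 0 (Set.Ioi 0), ∀ x ∈ X, x + τ • v x ∈ U ∧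
      x + τ • v x ∉ S ∪ T :=
    (Filter.eventually_all_finset X).mpr fun x hx =>
      eventually_fresh hU (hTU (hXv x hx).1) (hS.union hT) (hXv x hx).2
  -- Fresh nodes of different points may coincide; keeping the one of `x₀` apart is enough for `g ≠
  -- 0`.
  have hev2 : ∀ᶠ τ : ℝ in nhdsWithin 0 (Set.Ioi 0), ∀ x ∈ X, x ≠ x₀ →
      x₀ + τ • v x₀ ≠ x + τ • v x := by
    refine (Filter.eventually_all_finset X).mpr fun x _ => ?_
    by_cases hxx : x = x₀
    · simp [hxx]
    · have hc1 : Continuous fun τ : ℝ => x₀ + τ • v x₀ := by fun_prop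
      have hc2 : Continuous fun τ : ℝ => x + τ • v x := by fun_prop
      have hopen : IsOpen {τ : ℝ | x₀ + τ • v x₀ ≠ x + τ • v x} := isOpen_ne_fun hc1 hc2
      have := hopen.mem_nhds (show (0 : ℝ) ∈ _ by simpa using Ne.symm hxx)
      filter_upwards [nhdsWithin_le_nhds this] with τ hτ _ using hτ
  obtain ⟨τ, ⟨h1, h2⟩, hτ⟩ := ((hev1.and hev2).and self_mem_nhdsWithin).exists
  have hτ0 : τ ≠ 0 := ne_of_gt hτ
  obtain ⟨J, hJ⟩ : ∃ J, J = X.image fun x => x + τ • v x := ⟨_, rfl⟩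
  have hmemJ : ∀ x ∈ X, x + τ • v x ∈ (J : Set (EuclideanSpace ℝ (Fin d))) := fun x hx => by
    rw [hJ]
    exact_mod_cast Finset.mem_image_of_mem _ hx
  have hJp : ∀ y ∈ (J : Set (EuclideanSpace ℝ (Fin d))), y ∈ U ∧ y ∉ S ∪ T := fun y hy => by
    rw [hJ] at hy
    obtain ⟨x, hx, rfl⟩ := Finset.mem_image.mp (Finset.mem_coe.mp hy)
    exact h1 x hx
  obtain ⟨g, hg⟩ : ∃ g : Dof d →₀ ℝ, g = ∑ x ∈ X, load (x + τ • v x) (-v x) := ⟨_, rfl⟩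
  have hgJ : LoadedOn (J : Set (EuclideanSpace ℝ (Fin d))) g := fun a ha => by
    by_contra hcon
    apply ha
    rw [hg, Finsupp.finsetSum_apply]
    exact Finset.sum_eq_zero fun x hx => (loadedOn_load (hmemJ x hx) _).eq_zero hcon
  have hg0 : g ≠ 0 := fun h => hx₀ (by
    have h3 := DFunLike.congr_fun h (x₀ + τ • v x₀, k₀)
    rw [hg, Finsupp.finsetSum_apply, Finset.sum_eq_single_of_mem x₀ hx₀X fun x hx hne =>
      load_apply_of_ne (h2 x hx hne) _ _, load_apply_same] at h3
    simpa [hvk] using h3)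
  have hTJ : Disjoint T (J : Set (EuclideanSpace ℝ (Fin d))) :=
    Set.disjoint_right.mpr fun y hy h => (hJp y hy).2 (Or.inr h)
  have hsupp : Supported U D (T ∪ J) (r + g) := by
    refine supported_of_mem_span hd hU (hT.union J.finite_toSet)
      (Set.union_subset hTU fun y hy => (hJp y hy).1) ?_
    rw [hg]
    nth_rewrite 1 [hsum]
    rw [← Finset.sum_add_distrib]
    refine Submodule.sum_mem _ fun x hx => ?_
    have e : load x (v x) + load (x + τ • v x) (-v x) = (-τ⁻¹) • bar x (x + τ • v x) := by
      have e1 : x - (x + τ • v x) = (-τ) • v x := by module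
      rw [bar, e1, load_smul, load_smul, ← smul_sub, smul_smul, neg_mul_neg, inv_mul_cancel₀ hτ0,
        one_smul, load_neg, sub_eq_add_neg]
    rw [e]
    exact Submodule.smul_mem _ _ (Submodule.subset_span
      ⟨x, Or.inl (hXv x hx).1, _, Or.inr (hmemJ x hx), rfl⟩)
  refine ⟨J, _, J.finite_toSet, fun y hy => (hJp y hy).1,
    Set.disjoint_right.mpr fun y hy h => (hJp y hy).2 (Or.inl h), hTJ,
    (Synthesizable.smul hsupp (inv_nonneg.mpr hσ.le)).add (synthesizable_mass
      (μ := fun p => if p ∈ (J : Set (EuclideanSpace ℝ (Fin d))) then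
        (∑ b ∈ g.support, g b ^ 2) / σ ^ 2 else 0) (fun p => ?_) fun p hp => ?_), fun z hz => ?_⟩
  · split_ifs
    · exact div_nonneg (Finset.sum_nonneg fun b _ => sq_nonneg _) (sq_nonneg _)
    · exact le_rfl
  · exact if_neg fun h => hp (Or.inr h)
  · exact condenses_resonance hr hgJ hTJ hg0 hσ.ne' (hD z hz)

end Dof

/-! ### Terminal vectors as systems of forces, and Gram factorizations. -/

namespace Dof

variable {d : ℕ} {U : Set (EuclideanSpace ℝ (Fin d))} {D : Set (ℂ × ℂ)}
  {T : Set (EuclideanSpace ℝ (Fin d))}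

theorem finsupp_sum_eq_sum {ι κ M : Type*} [Fintype κ] [AddCommMonoid M] {f : ι →₀ ℝ}
    {ψ : κ → ι} (hψ : Function.Injective ψ) (hf : ∀ a, f a ≠ 0 → a ∈ Set.range ψ)
    {h : ι → ℝ → M} (h0 : ∀ a, h a 0 = 0) : f.sum h = ∑ b, h (ψ b) (f (ψ b)) := by
  classical
  rw [Finsupp.sum_of_support_subset f (s := Finset.univ.image ψ) (fun a ha => ?_) h
    fun a _ => h0 a, Finset.sum_image fun a _ b _ hab => hψ hab]
  obtain ⟨b, rfl⟩ := hf a (Finsupp.mem_support_iff.mp ha)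
  simp

theorem work_eq_sum_of_injective {κ : Type*} [Fintype κ] {f : Dof d →₀ ℝ} {ψ : κ → Dof d}
    (hψ : Function.Injective ψ) (hf : ∀ a, f a ≠ 0 → a ∈ Set.range ψ) (u : Dof d → ℂ) :
    work f u = ∑ b, (f (ψ b) : ℂ) * u (ψ b) := by
  rw [work, Finsupp.linearCombination_apply, finsupp_sum_eq_sum hψ hf (by simp)]
  simp

/-- The forces `v` applied at the points `x`. -/
noncomputable def place {n : ℕ} (x : Fin n → EuclideanSpace ℝ (Fin d)) (v : Fin n × Fin d → ℝ) :
    Dof d →₀ ℝ :=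
  Finsupp.mapDomain (Prod.map x id) (Finsupp.equivFunOnFinite.symm v)

variable {n : ℕ} {x : Fin n → EuclideanSpace ℝ (Fin d)}

theorem place_apply (hx : Function.Injective x) (v : Fin n × Fin d → ℝ) (i : Fin n) (k : Fin d) :
    place x v (x i, k) = v (i, k) :=
  Finsupp.mapDomain_apply (hx.prodMap Function.injective_id)
    (Finsupp.equivFunOnFinite.symm v) (i, k)

theorem work_place (v : Fin n × Fin d → ℝ) (u : Dof d → ℂ) :
    work (place x v) u = ∑ a : Fin n × Fin d, (v a : ℂ) * u (x a.1, a.2) := by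
  rw [work, place, Finsupp.linearCombination_mapDomain, Finsupp.linearCombination_apply,
    Finsupp.sum_fintype _ _ (by simp)]
  simp [Prod.map]

theorem loadedOn_place (v : Fin n × Fin d → ℝ) : LoadedOn (Set.range x) (place x v) := by
  intro a ha
  by_contra h
  refine ha (Finsupp.mapDomain_of_notMem_range _ _ ?_)
  rintro ⟨b, rfl⟩
  exact h ⟨b.1, rfl⟩

theorem balanced_place {v : Fin n × Fin d → ℝ} (hv : IsBalanced x v) : Balanced (place x v) := by
  intro c B hB
  rw [place, Finsupp.linearCombination_mapDomain, Finsupp.linearCombination_apply,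
    Finsupp.sum_fintype _ _ (by simp), Fintype.sum_prod_type_right]
  simp only [Finsupp.equivFunOnFinite_symm_apply_apply, Function.comp_apply, Prod.map_apply, id,
    smul_eq_mul, mul_add, Finset.sum_add_distrib]
  have h1 : ∑ k, ∑ i, v (i, k) * c k = 0 :=
    Finset.sum_eq_zero fun k _ => by rw [← Finset.sum_mul, hv.1 k, zero_mul]
  -- Vanishing total moment means that `Q` is symmetric, so its pairing with the antisymmetric `B`
  -- vanishes.
  obtain ⟨Q, hQ⟩ : ∃ Q : Fin d → Fin d → ℝ, Q = fun k t => ∑ i, v (i, k) * x i t := ⟨_, rfl⟩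
  have hQs : ∀ k t, Q k t = Q t k := fun k t => by
    have := hv.2 t k
    rw [Finset.sum_sub_distrib, sub_eq_zero] at this
    simp only [hQ, mul_comm (v _)]
    exact this
  have h2 : ∑ k, ∑ i, v (i, k) * ∑ t, B k t * x i t = ∑ k, ∑ t, B k t * Q k t := by
    refine Finset.sum_congr rfl fun k _ => ?_
    simp only [hQ, Finset.mul_sum]
    rw [Finset.sum_comm]
    exact Finset.sum_congr rfl fun t _ => Finset.sum_congr rfl fun i _ => by ring
  have h3 : ∑ k, ∑ t, B k t * Q k t = -∑ k, ∑ t, B k t * Q k t := by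
    conv_lhs => rw [Finset.sum_comm]
    simp only [← Finset.sum_neg_distrib]
    refine Finset.sum_congr rfl fun k _ => Finset.sum_congr rfl fun t _ => ?_
    rw [hB t k, hQs t k]
    ring
  rw [h1, h2]
  linarith

theorem isBalanced_iff (v : Fin n × Fin d → ℝ) : IsBalanced x v ↔
    (∀ s, v ⬝ᵥ (fun a => if a.2 = s then 1 else 0) = 0) ∧
    ∀ s t, v ⬝ᵥ (fun a =>
      (if a.2 = t then x a.1 s else 0) - if a.2 = s then x a.1 t else 0) = 0 := by
  simp [IsBalanced, dotProduct, Fintype.sum_prod_type, mul_sub, Finset.sum_sub_distrib, mul_comm]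

/-- Being balanced is orthogonality to a family of vectors `w`, and BᵀB w = 0 forces B w = 0;
balance thus passes from the columns of BᵀB to the rows of `B`. -/
theorem isBalanced_of_gram {ι : Type*} [Fintype ι] {B : Matrix ι (Fin n × Fin d) ℝ}
    (h : ∀ b, IsBalanced x fun a => (B.transpose * B) a b) (c : ι) : IsBalanced x (B c) := by
  have key : ∀ w : Fin n × Fin d → ℝ, (∀ b, (fun a => (B.transpose * B) a b) ⬝ᵥ w = 0) →
      B c ⬝ᵥ w = 0 := fun w hw => by
    have h1 : (B.conjTranspose * B).mulVec w = 0 := by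
      funext b
      rw [Pi.zero_apply, ← hw b, Matrix.conjTranspose_eq_transpose_of_trivial]
      refine Finset.sum_congr rfl fun a _ => ?_
      have : (B.transpose * B) b a = (B.transpose * B) a b := by
        simp [Matrix.mul_apply, mul_comm]
      exact congrArg (· * w a) this
    rw [Matrix.conjTranspose_mul_self_mulVec_eq_zero] at h1
    exact congrFun h1 c
  rw [isBalanced_iff]
  exact ⟨fun s => key _ fun b => ((isBalanced_iff _).mp (h b)).1 s,
    fun s t => key _ fun b => ((isBalanced_iff _).mp (h b)).2 s t⟩

theorem exists_gram {ι : Type*} [Finite ι] {A : Matrix ι ι ℝ} (hA : A.PosSemidef) :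
    ∃ (m : ℕ) (B : Matrix (Fin m) ι ℝ), A = B.transpose * B := by
  obtain ⟨m, v, rfl⟩ := Matrix.posSemidef_iff_eq_sum_vecMulVec.mp hA
  refine ⟨m, Matrix.of v, ?_⟩
  ext a b
  simp [Matrix.sum_apply, Matrix.vecMulVec_apply, Matrix.mul_apply]

theorem sum_rankOne_place (hx : Function.Injective x) {ι : Type*} [Fintype ι]
    (B : Matrix ι (Fin n × Fin d) ℝ) (u : Dof d → ℂ) (i : Fin n) (k : Fin d) :
    ∑ c, rankOne (place x (B c)) u (x i, k) =
      ((B.transpose * B).map Complex.ofReal).mulVec (fun a => u (x a.1, a.2)) (i, k) := by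
  simp only [rankOne, work_place, place_apply hx, Matrix.mulVec, dotProduct, Matrix.map_apply,
    Matrix.mul_apply, Matrix.transpose_apply, Complex.ofReal_sum, Finset.sum_mul]
  rw [Finset.sum_comm]
  refine Finset.sum_congr rfl fun a _ => Finset.sum_congr rfl fun c _ => ?_
  push_cast
  ring

end Dof

/-! ### From families of points and bars to damped networks. -/

namespace DampedNetwork

variable {d n m : ℕ}

theorem bar_pos_apply (N : DampedNetwork d n m) (p q i : Fin n ⊕ Fin m) (s : Fin d) :
    Dof.bar (N.pos p) (N.pos q) (N.pos i, s) =
      ((Pi.single p 1 - Pi.single q 1 : Fin n ⊕ Fin m → ℝ) i) *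
        (N.pos p - N.pos q) s := by
  rcases eq_or_ne p q with rfl | hpq
  · simp [Dof.bar, Dof.load_zero]
  have hne : N.pos p ≠ N.pos q := N.pos_injective.ne hpq
  rcases eq_or_ne i p with rfl | hip
  · simp [Dof.bar_apply_left hne, hpq]
  rcases eq_or_ne i q with rfl | hiq
  · simp [Dof.bar_apply_right hne, hip]
  · rw [Dof.bar_apply_of_ne (N.pos_injective.ne hip) (N.pos_injective.ne hiq)]
    simp [hip, hiq]

theorem norm_sq_mul_bondMatrix (N : DampedNetwork d n m) (p q : Fin n ⊕ Fin m)
    (a b : (Fin n ⊕ Fin m) × Fin d) :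
    ‖N.pos p - N.pos q‖ ^ 2 * N.bondMatrix p q a b =
      Dof.bar (N.pos p) (N.pos q) (N.pos a.1, a.2) *
        Dof.bar (N.pos p) (N.pos q) (N.pos b.1, b.2) := by
  rcases eq_or_ne p q with rfl | hpq
  · simp [Dof.bar, Dof.load_zero]
  have hne : ‖N.pos p - N.pos q‖ ≠ 0 :=
    norm_ne_zero_iff.mpr (sub_ne_zero.mpr (N.pos_injective.ne hpq))
  simp only [bar_pos_apply, bondMatrix, Matrix.kronecker, Matrix.kroneckerMap_apply,
    Matrix.vecMulVec_apply, dir, PiLp.smul_apply, smul_eq_mul]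
  field_simp

theorem nodeDof_injective (N : DampedNetwork d n m) :
    Function.Injective fun b : (Fin n ⊕ Fin m) × Fin d => (N.pos b.1, b.2) :=
  fun a b h => by
    simp only [Prod.mk.injEq] at h
    exact Prod.ext (N.pos_injective h.1) h.2

/-- `Dof.bar` is not normalized: a spring constant is a force density times the squared length,
whence the factor in `hN`. Both orderings of a pair contribute to it, which the factor 1/2 in the
stiffness matrix absorbs. -/
theorem stiffnessMatrix_mulVec (N : DampedNetwork d n m)
    {k : EuclideanSpace ℝ (Fin d) × EuclideanSpace ℝ (Fin d) →₀ ℝ}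
    (hk : ∀ p q, k (p, q) ≠ 0 → p ∈ Set.range N.pos ∧ q ∈ Set.range N.pos)
    (hN : ∀ i j, N.spring i j = (k (N.pos i, N.pos j) + k (N.pos j, N.pos i)) *
      ‖N.pos i - N.pos j‖ ^ 2) (u : Dof d → ℂ) (a : (Fin n ⊕ Fin m) × Fin d) :
    (N.stiffnessMatrix.map Complex.ofReal).mulVec (fun b => u (N.pos b.1, b.2)) a =
      Dof.springForce k u (N.pos a.1, a.2) := by
  have hwork : ∀ p q, Dof.work (Dof.bar (N.pos p) (N.pos q)) u =
      ∑ b : (Fin n ⊕ Fin m) × Fin d,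
        (Dof.bar (N.pos p) (N.pos q) (N.pos b.1, b.2) : ℂ) * u (N.pos b.1, b.2) := fun p q =>
    Dof.work_eq_sum_of_injective N.nodeDof_injective (fun c hc => by
      rcases Dof.bar_apply_ne_zero hc with h | h
      · exact ⟨(p, c.2), Prod.ext h.symm rfl⟩
      · exact ⟨(q, c.2), Prod.ext h.symm rfl⟩) u
  have hentry : ∀ b, (N.stiffnessMatrix a b : ℂ) = (1 / 2 : ℂ) * ∑ p, ∑ q,
      ((k (N.pos p, N.pos q) : ℂ) + k (N.pos q, N.pos p)) *
        (Dof.bar (N.pos p) (N.pos q) (N.pos a.1, a.2) *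
        Dof.bar (N.pos p) (N.pos q) (N.pos b.1, b.2)) := fun b => by
    simp only [stiffnessMatrix, Matrix.smul_apply, Matrix.sum_apply, smul_eq_mul, hN, mul_assoc,
      norm_sq_mul_bondMatrix]
    push_cast
    rfl
  have hforce : Dof.springForce k u (N.pos a.1, a.2) = ∑ p, ∑ q,
      (k (N.pos p, N.pos q) : ℂ) *
        Dof.rankOne (Dof.bar (N.pos p) (N.pos q)) u (N.pos a.1, a.2) := by
    rw [Dof.springForce, Dof.finsupp_sum_eq_sum (N.pos_injective.prodMap N.pos_injective)
      (fun e he => ?_) (by simp), Fintype.sum_prod_type]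
    · rfl
    · obtain ⟨⟨p, hp⟩, q, hq⟩ := hk e.1 e.2 he
      exact ⟨(p, q), Prod.ext hp hq⟩
  have hswap : Dof.springForce k u (N.pos a.1, a.2) = ∑ p, ∑ q,
      (k (N.pos q, N.pos p) : ℂ) *
        Dof.rankOne (Dof.bar (N.pos p) (N.pos q)) u (N.pos a.1, a.2) := by
    rw [hforce, Finset.sum_comm]
    simp only [fun p q => Dof.bar_comm (N.pos p) (N.pos q)]
  have hhalf : Dof.springForce k u (N.pos a.1, a.2) = (1 / 2 : ℂ) * ∑ p, ∑ q,
      ((k (N.pos p, N.pos q) : ℂ) + k (N.pos q, N.pos p)) *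
        Dof.rankOne (Dof.bar (N.pos p) (N.pos q)) u (N.pos a.1, a.2) := by
    simp only [add_mul, Finset.sum_add_distrib]
    rw [← hforce, ← hswap]
    ring
  rw [hhalf]
  simp only [Matrix.mulVec, dotProduct, Matrix.map_apply, hentry, Dof.rankOne, hwork,
    Finset.mul_sum, Finset.sum_mul]
  rw [Finset.sum_comm]
  refine Finset.sum_congr rfl fun p _ => ?_
  rw [Finset.sum_comm]
  refine Finset.sum_congr rfl fun q _ => Finset.sum_congr rfl fun b _ => ?_
  ring

theorem dynamicMatrix_mulVec (N : DampedNetwork d n m) {α β : ℝ} (hR : N.IsRayleigh α β)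
    {k : EuclideanSpace ℝ (Fin d) × EuclideanSpace ℝ (Fin d) →₀ ℝ}
    {μ : EuclideanSpace ℝ (Fin d) → ℝ}
    (hk : ∀ p q, k (p, q) ≠ 0 → p ∈ Set.range N.pos ∧ q ∈ Set.range N.pos)
    (hN : ∀ i j, N.spring i j = (k (N.pos i, N.pos j) + k (N.pos j, N.pos i)) *
      ‖N.pos i - N.pos j‖ ^ 2) (hμ : ∀ i, N.mass i = μ (N.pos i)) (z : ℂ) (u : Dof d → ℂ)
    (a : (Fin n ⊕ Fin m) × Fin d) :
    (N.dynamicMatrix z).mulVec (fun b => u (N.pos b.1, b.2)) a =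
      Dof.netForce k μ (1 + α * z, β * z + z ^ 2) u (N.pos a.1, a.2) := by
  have h : N.dynamicMatrix z = (1 + α * z) • N.stiffnessMatrix.map Complex.ofReal +
      (β * z + z ^ 2) • N.massMatrix.map Complex.ofReal := by
    ext a b
    simp only [dynamicMatrix, hR.dampingMatrix_eq, Matrix.add_apply, Matrix.smul_apply,
      Matrix.map_apply, smul_eq_mul]
    push_cast
    ring
  have hmass : (N.massMatrix.map Complex.ofReal).mulVec (fun b => u (N.pos b.1, b.2)) a =
      (μ (N.pos a.1) : ℂ) * u (N.pos a.1, a.2) := by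
    rw [massMatrix, Matrix.diagonal_map Complex.ofReal_zero, Matrix.mulVec_diagonal, hμ]
  rw [h, Matrix.add_mulVec, Matrix.smul_mulVec, Matrix.smul_mulVec, Pi.add_apply, Pi.smul_apply,
    Pi.smul_apply, hmass, N.stiffnessMatrix_mulVec hk hN, Dof.netForce, smul_eq_mul, smul_eq_mul]

/-- A synthesizable response is the response of a damped network. -/
theorem exists_of_synthesizable {U S : Set (EuclideanSpace ℝ (Fin d))} {D : Set (ℂ × ℂ)}
    {x : Fin n → EuclideanSpace ℝ (Fin d)} (hx : Function.Injective x)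
    {Φ : ℂ × ℂ → (Dof d → ℂ) → Dof d → ℂ} (hΦ : Dof.Synthesizable U D (Set.range x) Φ)
    (hS : S.Finite) {α β : ℝ} (hα : 0 ≤ α) (hβ : 0 ≤ β)
    {W : ℂ → Matrix (Fin n × Fin d) (Fin n × Fin d) ℂ}
    (hW : ∀ z u i s, ((1 + α * z, β * z + z ^ 2) : ℂ × ℂ) ∈ D →
      Φ (1 + α * z, β * z + z ^ 2) u (x i, s) = (W z).mulVec (fun a => u (x a.1, a.2)) (i, s)) :
    ∃ (m : ℕ) (N : DampedNetwork d n m),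
      (∀ i, N.pos (Sum.inl i) = x i) ∧
      N.IsRayleigh α β ∧
      (∀ z : ℂ, ((1 + α * z, β * z + z ^ 2) : ℂ × ℂ) ∈ D → N.IsResponseAt z (W z)) ∧
      ∀ l, N.pos (Sum.inr l) ∉ S ∧ N.pos (Sum.inr l) ∈ U := by
  obtain ⟨hloc, hsyn⟩ := hΦ
  obtain ⟨I, k, μ, hI, hIU, hSI, hTI, hk, hkI, hμ, hμI, hc⟩ := hsyn S hS
  have := hI.to_subtype
  obtain ⟨m, ⟨e⟩⟩ := Finite.exists_equiv_fin I
  obtain ⟨y, hy⟩ : ∃ y : Fin m → EuclideanSpace ℝ (Fin d), y = fun l => (e.symm l).1 := ⟨_, rfl⟩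
  have hyI : ∀ l, y l ∈ I := fun l => by
    rw [hy]
    exact (e.symm l).2
  have hyr : ∀ p ∈ I, ∃ l, y l = p := fun p hp => ⟨e ⟨p, hp⟩, by simp [hy]⟩
  have hyinj : Function.Injective y := by
    rw [hy]
    exact Subtype.val_injective.comp e.symm.injective
  have hpos : Function.Injective (Sum.elim x y) :=
    hx.sumElim hyinj fun i l h => Set.disjoint_left.mp hTI ⟨i, rfl⟩ (h ▸ hyI l)
  let N : DampedNetwork d n m :=
    { pos := Sum.elim x y
      pos_injective := hpos
      spring := fun i j => (k (Sum.elim x y i, Sum.elim x y j) +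
        k (Sum.elim x y j, Sum.elim x y i)) * ‖Sum.elim x y i - Sum.elim x y j‖ ^ 2
      spring_symm := fun i j => by rw [norm_sub_rev, add_comm]
      spring_nonneg := fun i j => mul_nonneg (add_nonneg (hk _) (hk _)) (sq_nonneg _)
      dashpot := fun i j => α * ((k (Sum.elim x y i, Sum.elim x y j) +
        k (Sum.elim x y j, Sum.elim x y i)) * ‖Sum.elim x y i - Sum.elim x y j‖ ^ 2)
      dashpot_symm := fun i j => by rw [norm_sub_rev, add_comm]
      dashpot_nonneg := fun i j =>
        mul_nonneg hα (mul_nonneg (add_nonneg (hk _) (hk _)) (sq_nonneg _))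
      mass := fun i => μ (Sum.elim x y i)
      mass_nonneg := fun i => hμ _
      cavity := fun i => β * μ (Sum.elim x y i)
      cavity_nonneg := fun i => mul_nonneg hβ (hμ _) }
  have hR : N.IsRayleigh α β := ⟨fun _ _ => rfl, fun _ => rfl⟩
  have hrange : ∀ p ∈ Set.range x ∪ I, p ∈ Set.range N.pos := by
    rintro p (⟨i, rfl⟩ | hp)
    · exact ⟨Sum.inl i, rfl⟩
    · obtain ⟨l, rfl⟩ := hyr p hp
      exact ⟨Sum.inr l, rfl⟩
  have hdyn : ∀ (z : ℂ) (u : Dof d → ℂ) (a : (Fin n ⊕ Fin m) × Fin d),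
      (N.dynamicMatrix z).mulVec (fun b => u (N.pos b.1, b.2)) a =
        Dof.netForce k μ (1 + α * z, β * z + z ^ 2) u (N.pos a.1, a.2) :=
    N.dynamicMatrix_mulVec hR
      (fun p q h => ⟨hrange p (hkI p q h).1, hrange q (hkI p q h).2⟩) (fun _ _ => rfl)
      fun _ => rfl
  refine ⟨m, N, fun _ => rfl, hR, fun z hz uB fB => ?_, fun l =>
    ⟨fun h => Set.disjoint_left.mp hSI h (hyI l), hIU (hyI l)⟩⟩
  constructor
  · rintro ⟨u, hu, hf, h0⟩
    -- Nodes are distinct, so node displacements extend to a field on all of space.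
    obtain ⟨v, hv⟩ : ∃ v : Dof d → ℂ, ∀ b : (Fin n ⊕ Fin m) × Fin d, v (N.pos b.1, b.2) = u b :=
      ⟨Function.extend (fun b : (Fin n ⊕ Fin m) × Fin d => (N.pos b.1, b.2)) u 0,
        fun b => N.nodeDof_injective.extend_apply u 0 b⟩
    have hvu : (fun b : (Fin n ⊕ Fin m) × Fin d => v (N.pos b.1, b.2)) = u := funext hv
    have hfor : ∀ a, Dof.netForce k μ (1 + α * z, β * z + z ^ 2) v (N.pos a.1, a.2) =
        (N.dynamicMatrix z).mulVec u a := fun a => by rw [← hdyn, hvu]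
    have hΦv := (hc _ hz).2 v fun a ha => by
      obtain ⟨l, hl⟩ := hyr a.1 ha
      have := hfor (Sum.inr l, a.2)
      rw [h0] at this
      rw [← this]
      exact congrArg _ (Prod.ext hl.symm rfl)
    funext b
    have h1 := hfor (Sum.inl b.1, b.2)
    rw [hf] at h1
    rw [← h1, hΦv]
    refine (hW z v b.1 b.2 hz).trans ?_
    congr 1
    funext a
    exact (hv (Sum.inl a.1, a.2)).trans (hu a.1 a.2)
  · rintro rfl
    obtain ⟨u₀, hu₀⟩ : ∃ u₀ : Dof d → ℂ, ∀ a : Fin n × Fin d, u₀ (x a.1, a.2) = uB a :=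
      ⟨Function.extend (Prod.map x id) uB 0,
        fun a => (hx.prodMap Function.injective_id).extend_apply uB 0 a⟩
    obtain ⟨v, hv, hΦv⟩ := (hc _ hz).1 u₀
    refine ⟨fun b => v (N.pos b.1, b.2), fun i s => ?_, fun i s => ?_, fun l s => ?_⟩
    · exact (hv (x i, s) fun h => Set.disjoint_left.mp hTI ⟨i, rfl⟩ h).trans (hu₀ (i, s))
    · rw [hdyn, hΦv]
      refine (hW z u₀ i s hz).trans ?_
      congr 1
      funext a
      exact hu₀ a
    · rw [hdyn, hΦv]
      exact (hloc _).2 u₀ _ fun h => Set.disjoint_left.mp hTI h (hyI l)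

end DampedNetwork

/-! ### Assembly of the network. -/

theorem theorem5p2 {d n p : ℕ} (hd : d = 2 ∨ d = 3) (α β : ℝ) (hα : 0 ≤ α) (hβ : 0 ≤ β)
    (x : Fin n → EuclideanSpace ℝ (Fin d)) (hx : Function.Injective x)
    (A M : Matrix (Fin n × Fin d) (Fin n × Fin d) ℝ)
    (σ : Fin p → ℝ) (R : Fin p → Matrix (Fin n × Fin d) (Fin n × Fin d) ℝ)
    (hσ : ∀ j, 0 < σ j)
    (hR : ∀ j, (R j).PosSemidef)
    (hM : ∃ μ : Fin n → ℝ, (∀ i, 0 ≤ μ i) ∧ M = Matrix.diagonal fun a => μ a.1)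
    (hA : A.PosSemidef)
    (hW0 : (A - ∑ j, (σ j)⁻¹ • R j).PosSemidef)
    (hbal : ∀ b, IsBalanced x fun a => (A - ∑ j, (σ j)⁻¹ • R j) a b)
    (ε : ℝ) (hε : 0 < ε) (S : Set (EuclideanSpace ℝ (Fin d))) (hS : S.Finite) :
    ∃ (m : ℕ) (N : DampedNetwork d n m),
      (∀ i, N.pos (Sum.inl i) = x i) ∧
      N.IsRayleigh α β ∧
      (∀ z : ℂ, (∀ j, resonancePoly α β (σ j) z ≠ 0) →
        N.IsResponseAt z (rationalResponse α β A M σ R z)) ∧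
      ∀ l, N.pos (Sum.inr l) ∉ S ∧
        N.pos (Sum.inr l) ∈ Metric.thickening ε (convexHull ℝ (Set.range x)) := by
  have hd2 : 2 ≤ d := by omega
  obtain ⟨μ, hμ, rfl⟩ := hM
  obtain ⟨m₀, B₀, hB₀⟩ := Dof.exists_gram hW0
  choose m B hB using fun j => Dof.exists_gram (hR j)
  have hq : ∀ j z, resonancePoly α β (σ j) z = (1 + α * z) * σ j + (β * z + z ^ 2) := fun j z => by
    rw [resonancePoly]
    ring
  obtain ⟨U, hU⟩ : ∃ U, U = Metric.thickening ε (convexHull ℝ (Set.range x)) := ⟨_, rfl⟩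
  obtain ⟨D, hD⟩ : ∃ D : Set (ℂ × ℂ),
    D = {z : ℂ × ℂ | ∀ j, z.1 * (σ j : ℂ) + z.2 ≠ 0} := ⟨_, rfl⟩
  have hUo : IsOpen U := hU ▸ Metric.isOpen_thickening
  have hTU : Set.range x ⊆ U := by
    rw [hU]
    exact (subset_convexHull ℝ _).trans (Metric.self_subset_thickening hε _)
  have hT : (Set.range x).Finite := Set.finite_range x
  have hstat : Dof.Synthesizable U D (Set.range x)
      (∑ c, fun z : ℂ × ℂ => z.1 • Dof.rankOne (Dof.place x (B₀ c))) :=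
    Dof.Synthesizable.sum _ fun c _ => Dof.supported_of_balanced hd2 hUo hT hTU
      (Dof.loadedOn_place _) (Dof.balanced_place
        (Dof.isBalanced_of_gram (fun b => by rw [← hB₀]; exact hbal b) c))
  have hres : Dof.Synthesizable U D (Set.range x) (∑ j, ∑ c, fun z : ℂ × ℂ =>
      (z.1 * z.2 / (σ j * (z.1 * σ j + z.2))) • Dof.rankOne (Dof.place x (B j c))) :=
    Dof.Synthesizable.sum _ fun j _ => Dof.Synthesizable.sum _ fun c _ =>
      Dof.synthesizable_resonance hd2 hUo hT hTU (Dof.loadedOn_place _) (hσ j)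
        fun z hz => by
          rw [hD] at hz
          exact hz j
  have hmass : Dof.Synthesizable U D (Set.range x) fun z u a =>
      z.2 * (((Function.extend x μ 0 a.1 : ℝ) : ℂ) * u a) := by
    refine Dof.synthesizable_mass (fun q => ?_) fun q hq => Function.extend_apply' _ _ _ hq
    by_cases h : ∃ i, x i = q
    · obtain ⟨i, rfl⟩ := h
      rw [hx.extend_apply]
      exact hμ i
    · rw [Function.extend_apply' _ _ _ h]
      exact le_rfl
  have hmem : ∀ z : ℂ, ((1 + α * z, β * z + z ^ 2) : ℂ × ℂ) ∈ D ↔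
      ∀ j, resonancePoly α β (σ j) z ≠ 0 := fun z => by
    rw [hD]
    simp only [hq]
    rfl
  have hmain := DampedNetwork.exists_of_synthesizable hx ((hstat.add hmass).add hres) hS hα hβ
    (W := rationalResponse α β A (Matrix.diagonal fun a => μ a.1) σ R) fun z u i s hz => ?_
  · obtain ⟨m, N, h1, h2, h3, h4⟩ := hmain
    exact ⟨m, N, h1, h2, fun z hz => h3 z ((hmem z).mpr hz), fun l => hU ▸ h4 l⟩
  · obtain ⟨s', hs'⟩ : ∃ s' : ℂ, s' = 1 + α * z := ⟨_, rfl⟩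
    obtain ⟨w, hw⟩ : ∃ w : ℂ, w = β * z + z ^ 2 := ⟨_, rfl⟩
    have hz' : ∀ j, s' * σ j + w ≠ 0 := fun j => by
      have := (hmem z).mp hz j
      rwa [hq, ← hs', ← hw] at this
    obtain ⟨v, hv⟩ : ∃ v : Fin n × Fin d → ℂ, v = fun a => u (x a.1, a.2) := ⟨_, rfl⟩
    -- `A` is split into the static response W(0) and the static parts of the resonant terms.
    have hAe : A = B₀.transpose * B₀ + ∑ j, (σ j)⁻¹ • R j := by
      rw [← hB₀, sub_add_cancel]
    have hA' : (A.map Complex.ofReal).mulVec v (i, s) =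
        ((B₀.transpose * B₀).map Complex.ofReal).mulVec v (i, s) +
          ∑ j, (σ j : ℂ)⁻¹ * ((R j).map Complex.ofReal).mulVec v (i, s) := by
      rw [hAe]
      simp only [Matrix.mulVec, dotProduct, Matrix.map_apply, Matrix.add_apply, Matrix.sum_apply,
        Matrix.smul_apply, smul_eq_mul, Complex.ofReal_add, Complex.ofReal_sum,
        Complex.ofReal_mul, Complex.ofReal_inv, add_mul, Finset.sum_add_distrib, Finset.sum_mul,
        Finset.mul_sum, mul_assoc]
      rw [add_right_inj, Finset.sum_comm]
    have hres' : ∀ j, ∑ c, (s' * w / (σ j * (s' * σ j + w))) *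
        Dof.rankOne (Dof.place x (B j c)) u (x i, s) =
        (s' * w / (σ j * (s' * σ j + w))) * ((R j).map Complex.ofReal).mulVec v (i, s) :=
      fun j => by rw [← Finset.mul_sum, Dof.sum_rankOne_place hx, hB j, hv]
    have hstat' : ∑ c, s' * Dof.rankOne (Dof.place x (B₀ c)) u (x i, s) =
        s' * ((B₀.transpose * B₀).map Complex.ofReal).mulVec v (i, s) := by
      rw [← Finset.mul_sum, Dof.sum_rankOne_place hx, hv]
    rw [rationalResponse, ← hv]
    simp only [hq, ← hs', ← hw, Pi.add_apply, Finset.sum_apply, Pi.smul_apply, smul_eq_mul,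
      hres', hstat', hx.extend_apply, Matrix.sub_mulVec, Matrix.add_mulVec, Matrix.smul_mulVec,
      Matrix.sum_mulVec, Pi.sub_apply, hA', Matrix.diagonal_map Complex.ofReal_zero,
      Matrix.mulVec_diagonal]
    -- Partial fractions: s w / (σ(sσ + w)) = s/σ - s²/(sσ + w).
    have hterm : ∀ j, s' * w / (σ j * (s' * σ j + w)) * ((R j).map Complex.ofReal).mulVec v (i, s) =
        s' * ((σ j : ℂ)⁻¹ * ((R j).map Complex.ofReal).mulVec v (i, s)) -
          s' ^ 2 / (s' * σ j + w) * ((R j).map Complex.ofReal).mulVec v (i, s) := fun j => by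
      have h1 := hz' j
      have h2 : (σ j : ℂ) ≠ 0 := by exact_mod_cast (hσ j).ne'
      field_simp
      ring
    simp only [hterm, Finset.sum_sub_distrib, ← Finset.mul_sum]
    rw [show v (i, s) = u (x i, s) by rw [hv]]
    ring
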